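/- Let $M$ be a two-dimensional spacetime, i.e. a two-dimensional smooth Hausdorff manifold without boundary with a smooth Lorentzian metric $g$ (each $g_x$ is $\mathrm{diag}(-1,1)$ in a suitable basis of $T_xM$) and a time orientation, a continuous vector field $T$ with $g(T,T)<0$ everywhere. A tangent vector $v\in T_xM$ is *future directed causal* if $v\neq 0$, $g_x(v,v)\le 0$ and $g_x(T_x,v)<0$. Let $\alpha$ be the *after relation* on $M$: $x\mathrel{\alpha}y$ iff there are $a<b$ and a piecewise smooth curve $\gamma\colon[a,b]\to M$ with $\gamma(a)=x$ and $\gamma(b)=y$ all of whose velocity vectors (one-sided ones at end points and break points) are future directed causal. Then the Kripke frame $(M,\alpha)$ validates, i.e. makes true at every point under every evaluation of the atoms $p_1,p_2,q$, the modal formula $$a\alpha_2 f:\quad \lozenge(p_1\land\lnot p_2\land\square\lnot p_2)\land\lozenge(p_2\land\lnot p_1\land\square\lnot p_1)\land\lozenge q\;\Rightarrow\;\lozenge(\lozenge p_1\land\lozenge q)\lor\lozenge(\lozenge p_2\land\lozenge q).$$ Consequently $\mathbf{D4da_2}\subseteq\mathrm{Log}(M,\alpha)$. Here $\mathrm{Log}(M,\alpha)$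 is the set of all modal formulas valid in $(M,\alpha)$, and $\mathbf{D4da_2}$ is the smallest normal modal logic (a set of modal formulas that contains all propositional tautologies and all formulas $\square(A\Rightarrow B)\Rightarrow(\square A\Rightarrow\square B)$, and is closed under modus ponens, necessitation and uniform substitution) that contains $\lozenge\top$, all formulas $\lozenge\lozenge A\Rightarrow\lozenge A$ and $\lozenge A\Rightarrow\lozenge\lozenge A$, and $a\alpha_2 f$ with all its substitution instances. -/

import Mathlib

open scoped Manifold ContDiff
open Set Bundle

noncomputable section

/-! ## Propositional modal logic -/

/-- Modal formulas over the atomic propositions `AP`. -/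
inductive ModalFormula (AP : Type*) where
  | top : ModalFormula AP
  | atom (p : AP) : ModalFormula AP
  | or (φ ψ : ModalFormula AP) : ModalFormula AP
  | neg (φ : ModalFormula AP) : ModalFormula AP
  | box (φ : ModalFormula AP) : ModalFormula AP

namespace ModalFormula

variable {AP : Type*}

/-- `φ ∧ ψ`. -/
def and (φ ψ : ModalFormula AP) : ModalFormula AP := neg (or (neg φ) (neg ψ))

/-- `φ ⇒ ψ`. -/
def imp (φ ψ : ModalFormula AP) : ModalFormula AP := or (neg φ) ψ

/-- `◇ φ`. -/
def dia (φ : ModalFormula AP) : ModalFormula AP := neg (box (neg φ))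

/-- Truth of a formula at a point of the Kripke model with relation `R` and evaluation `V`. -/
def Sat {W : Type*} (R : W → W → Prop) (V : AP → Set W) : W → ModalFormula AP → Prop
  | _, top => True
  | x, atom p => x ∈ V p
  | x, or φ ψ => Sat R V x φ ∨ Sat R V x ψ
  | x, neg φ => ¬ Sat R V x φ
  | x, box φ => ∀ y, R x y → Sat R V y φ

/-- Validity of a formula in the Kripke frame `(W, R)`: truth under every evaluation, at every
point. -/
def ValidOn {W : Type*} (R : W → W → Prop) (φ : ModalFormula AP) : Prop :=
  ∀ (V : AP → Set W) (x : W), Sat R V x φ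

/-- The modal logic of the frame `(W, R)`: the set of its valid formulas. -/
def frameLogic (AP : Type*) {W : Type*} (R : W → W → Prop) : Set (ModalFormula AP) :=
  {φ | ValidOn R φ}

/-- Propositional truth value, where atoms and boxed formulas get arbitrary values from `v`. -/
def PropEval (v : ModalFormula AP → Prop) : ModalFormula AP → Prop
  | top => True
  | atom p => v (atom p)
  | or φ ψ => PropEval v φ ∨ PropEval v ψ
  | neg φ => ¬ PropEval v φ
  | box φ => v (box φ)

/-- Instances of classical propositional tautologies. -/
def IsTautology (φ : ModalFormula AP) : Prop := ∀ v : ModalFormula AP → Prop, PropEval v φ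

/-- Uniform substitution of formulas for atoms. -/
def subst (σ : AP → ModalFormula AP) : ModalFormula AP → ModalFormula AP
  | top => top
  | atom p => σ p
  | or φ ψ => or (subst σ φ) (subst σ ψ)
  | neg φ => neg (subst σ φ)
  | box φ => box (subst σ φ)

/-- `KDerivable Γ φ`: the formula `φ` belongs to the normal modal logic `K + Γ`, the smallest set
of formulas that contains the tautologies, the axiom `K` and `Γ`, and is closed under modus ponens,
necessitation and uniform substitution. -/
inductive KDerivable (Γ : Set (ModalFormula AP)) : ModalFormula AP → Prop
  | taut {φ : ModalFormula AP} (h : IsTautology φ) : KDerivable Γ φ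
  | axiomK (A B : ModalFormula AP) :
      KDerivable Γ (imp (box (imp A B)) (imp (box A) (box B)))
  | extra {φ : ModalFormula AP} (h : φ ∈ Γ) : KDerivable Γ φ
  | mp {φ ψ : ModalFormula AP} (h₁ : KDerivable Γ (imp φ ψ)) (h₂ : KDerivable Γ φ) :
      KDerivable Γ ψ
  | nec {φ : ModalFormula AP} (h : KDerivable Γ φ) : KDerivable Γ (box φ)
  | substitution {φ : ModalFormula AP} (σ : AP → ModalFormula AP) (h : KDerivable Γ φ) :
      KDerivable Γ (subst σ φ)

/-- The normal modal logic `K + Γ`. -/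
def normalLogic (Γ : Set (ModalFormula AP)) : Set (ModalFormula AP) := {φ | KDerivable Γ φ}

/-- Transitivity axiom `◇◇A ⇒ ◇A`. -/
def ax4 (A : ModalFormula AP) : ModalFormula AP := imp (dia (dia A)) (dia A)

/-- Seriality axiom `◇⊤`. -/
def axD : ModalFormula AP := dia top

/-- Density axiom `◇A ⇒ ◇◇A`. -/
def axDense (A : ModalFormula AP) : ModalFormula AP := imp (dia A) (dia (dia A))

/-- The after-2 formula
`◇(A ∧ ¬B ∧ □¬B) ∧ ◇(B ∧ ¬A ∧ □¬A) ∧ ◇C ⇒ ◇(◇A ∧ ◇C) ∨ ◇(◇B ∧ ◇C)`. -/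
def after2 (A B C : ModalFormula AP) : ModalFormula AP :=
  imp
    (and (and (dia (and (and A (neg B)) (box (neg B)))) (dia (and (and B (neg A)) (box (neg A)))))
      (dia C))
    (or (dia (and (dia A) (dia C))) (dia (and (dia B) (dia C))))

/-- The normal modal logic `D4da₂`: `K` with the transitivity, seriality, density and after-2
axioms (as schemes). -/
def logicD4da2 (AP : Type*) : Set (ModalFormula AP) :=
  normalLogic
    ({φ | ∃ A, φ = ax4 A} ∪ {axD} ∪ {φ | ∃ A, φ = axDense A} ∪ {φ | ∃ A B C, φ = after2 A B C})

end ModalFormula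

/-! ## Spacetimes -/

/-- A spacetime structure on the `d`-dimensional smooth manifold `M`: a smooth Lorentzian metric
and a continuous timelike vector field as time orientation. -/
structure Spacetime (d : ℕ) (M : Type*) [TopologicalSpace M]
    [ChartedSpace (EuclideanSpace ℝ (Fin d)) M] [IsManifold (𝓡 d) ∞ M] where
  /-- The bilinear form `g x` on the tangent space at `x`. -/
  g (x : M) : TangentSpace (𝓡 d) x →L[ℝ] TangentSpace (𝓡 d) x →L[ℝ] ℝ
  smooth_g : ContMDiff (𝓡 d)
    ((𝓡 d).prod 𝓘(ℝ, EuclideanSpace ℝ (Fin d) →L[ℝ] EuclideanSpace ℝ (Fin d) →L[ℝ] ℝ)) ∞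
    (fun x ↦ TotalSpace.mk' (EuclideanSpace ℝ (Fin d) →L[ℝ] EuclideanSpace ℝ (Fin d) →L[ℝ] ℝ)
      x (g x))
  /-- In a suitable basis of the tangent space, `g x` is `diag(-1, 1, …, 1)`, up to the order of
  the basis vectors. In particular `g x` is symmetric and nondegenerate. -/
  lorentzian (x : M) : ∃ (b : Module.Basis (Fin d) ℝ (TangentSpace (𝓡 d) x)) (i₀ : Fin d),
    ∀ i j, g x (b i) (b j) = if i = j then (if i = i₀ then -1 else 1) else 0
  /-- The time orientation, a vector field. -/
  T (x : M) : TangentSpace (𝓡 d) x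
  continuous_T : Continuous (fun x ↦ (⟨x, T x⟩ : TangentBundle (𝓡 d) M))
  timelike_T (x : M) : g x (T x) (T x) < 0

namespace Spacetime

variable {d : ℕ} {M : Type*} [TopologicalSpace M]
    [ChartedSpace (EuclideanSpace ℝ (Fin d)) M] [IsManifold (𝓡 d) ∞ M]

/-- A tangent vector is causal if it is nonzero and timelike or lightlike. -/
def IsCausal (S : Spacetime d M) {x : M} (v : TangentSpace (𝓡 d) x) : Prop :=
  v ≠ 0 ∧ S.g x v v ≤ 0

/-- Future directed tangent vectors. -/
def IsFutureDirected (S : Spacetime d M) {x : M} (v : TangentSpace (𝓡 d) x) : Prop :=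
  S.g x (S.T x) v < 0

/-- `γ` is smooth on `[a, b]` and all its velocity vectors there (one-sided at the end points) are
future directed causal. -/
def IsSmoothCausalOn (S : Spacetime d M) (γ : ℝ → M) (a b : ℝ) : Prop :=
  ContMDiffOn 𝓘(ℝ, ℝ) (𝓡 d) ∞ γ (Icc a b) ∧
    ∀ s ∈ Icc a b,
      S.IsCausal (mfderivWithin 𝓘(ℝ, ℝ) (𝓡 d) γ (Icc a b) s (1 : ℝ) : TangentSpace (𝓡 d) (γ s)) ∧
      S.IsFutureDirected
        (mfderivWithin 𝓘(ℝ, ℝ) (𝓡 d) γ (Icc a b) s (1 : ℝ) : TangentSpace (𝓡 d) (γ s))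

/-- `γ` is a piecewise smooth causal curve on the nondegenerate interval `[a, b]`: for some
partition `a = t 0 < t 1 < ⋯ < t k = b`, it is smooth and causal on each `[t i, t (i + 1)]`. -/
def IsCausalCurve (S : Spacetime d M) (γ : ℝ → M) (a b : ℝ) : Prop :=
  a < b ∧ ContinuousOn γ (Icc a b) ∧
    ∃ (k : ℕ) (t : ℕ → ℝ), t 0 = a ∧ t k = b ∧
      ∀ i < k, t i < t (i + 1) ∧ S.IsSmoothCausalOn γ (t i) (t (i + 1))

/-- The after relation `x α y`: there is a causal curve from `x` to `y`. -/
def After (S : Spacetime d M) (x y : M) : Prop :=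
  ∃ (γ : ℝ → M) (a b : ℝ), S.IsCausalCurve γ a b ∧ γ a = x ∧ γ b = y

end Spacetime

end

noncomputable section

/-! ### Modal soundness and the frame condition behind the after-2 formula -/

namespace ModalFormula

variable {AP W : Type*} {R : W → W → Prop} {V : AP → Set W} {x : W}

/-! By soundness it suffices that `After` is transitive, serial and dense and satisfies
`IsAfter2Frame`: if `x` sees `y₁`, `y₂`, `z` and `y₁`, `y₂` are distinct and incomparable, some `w`
after `x` precedes `z` and one of the `yᵢ`. The first three are easy: concatenate curves, follow a
short segment in the direction of the time orientation, stop halfway along a first smooth piece.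

For the frame condition, let `past y` be the interior of the causal past of `y`. If `x` lies in the
past of one of the three points, openness gives `w` on a short initial piece of a curve from `x` to
another one (`exists_after_of_mem_past`).

Otherwise each of the three causal curves from `x` is null and has no corners
(`After.exists_nullChain`). Indeed a timelike velocity, or a corner, lets nearby straight chart
segments replace a piece of the curve, so an earlier point is in the past of a later one; the
push-up property `After.mem_past` carries this back to `x`. Push-up itself rests on
`exists_deformation`: the start of a short causal curve can be moved freely while its end hardly
moves.

In dimension two there are only two future null directions at `x`, so two of the three curves start
in the same one. Null curves with a common initial direction agree for a while up to parametrization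
(`exists_common_point`, a Grönwall argument). If one of them leads to `z`, a point on the common
part is the required `w`. If they lead to `y₁` and `y₂`, the agreement propagates by compactness
until one curve ends on the other (`exists_orthogonal_end`, `NullChain.comparable`), so `y₁` and
`y₂` are equal or comparable, which is excluded. -/

theorem sat_and {φ ψ : ModalFormula AP} :
    Sat R V x (and φ ψ) ↔ Sat R V x φ ∧ Sat R V x ψ := by
  simp only [and, Sat]; tauto

theorem sat_imp {φ ψ : ModalFormula AP} :
    Sat R V x (imp φ ψ) ↔ (Sat R V x φ → Sat R V x ψ) := by
  simp only [imp, Sat]; tauto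

theorem sat_dia {φ : ModalFormula AP} :
    Sat R V x (dia φ) ↔ ∃ y, R x y ∧ Sat R V y φ := by
  simp only [dia, Sat]; push Not; rfl

/-- Truth at a fixed point is itself a propositional valuation of atoms and boxed formulas, so
tautologies hold at every point. -/
theorem sat_iff_propEval (φ : ModalFormula AP) :
    Sat R V x φ ↔ PropEval (Sat R V x) φ := by
  induction φ with
  | top => rfl
  | atom p => rfl
  | or φ ψ ih₁ ih₂ => simp only [Sat, PropEval, ih₁, ih₂]
  | neg φ ih => simp only [Sat, PropEval, ih]
  | box φ => rfl

/-- A substitution can be absorbed into the evaluation; since validity quantifies over all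
evaluations, it is closed under substitution. -/
theorem sat_subst (σ : AP → ModalFormula AP) (φ : ModalFormula AP) :
    Sat R V x (subst σ φ) ↔ Sat R (fun p ↦ {y | Sat R V y (σ p)}) x φ := by
  induction φ generalizing x with
  | top => rfl
  | atom p => rfl
  | or φ ψ ih₁ ih₂ => simp only [Sat, subst, ih₁, ih₂]
  | neg φ ih => simp only [Sat, subst, ih]
  | box φ ih => simp only [Sat, subst, ih]

/-- Soundness: the logic of a frame is a normal modal logic. -/
theorem normalLogic_subset_frameLogic {Γ : Set (ModalFormula AP)}
    (hΓ : Γ ⊆ frameLogic AP R) : normalLogic Γ ⊆ frameLogic AP R := by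
  intro φ hφ
  induction hφ with
  | taut h => exact fun V x ↦ (sat_iff_propEval _).2 (h _)
  | axiomK A B =>
    intro V x
    simp only [sat_imp, Sat]
    exact fun h₁ h₂ y hy ↦ h₁ y hy (h₂ y hy)
  | extra h => exact hΓ h
  | mp _ _ ih₁ ih₂ => exact fun V x ↦ sat_imp.1 (ih₁ V x) (ih₂ V x)
  | nec _ ih => exact fun V x y _ ↦ ih V y
  | substitution σ _ ih => exact fun V x ↦ (sat_subst σ _).2 (ih _ x)

/-- The frame condition that corresponds to the after-2 formula. -/
def IsAfter2Frame (R : W → W → Prop) : Prop :=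
  ∀ x y₁ y₂ z, R x y₁ → R x y₂ → R x z → y₁ ≠ y₂ → ¬ R y₁ y₂ → ¬ R y₂ y₁ →
    ∃ w, R x w ∧ R w z ∧ (R w y₁ ∨ R w y₂)

theorem validOn_after2 (hR : IsAfter2Frame R) (A B C : ModalFormula AP) :
    ValidOn R (after2 A B C) := by
  intro V x
  rw [after2, sat_imp]
  intro h
  simp only [sat_and, sat_dia, Sat] at h ⊢
  obtain ⟨⟨⟨y₁, hx₁, ⟨hA₁, hB₁⟩, hn₁⟩, ⟨y₂, hx₂, ⟨hB₂, hA₂⟩, hn₂⟩⟩, z, hxz, hz⟩ := h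
  -- `A` holds at `y₁` and `B` at `y₂`. The conjunct `¬B` at `y₁` separates the two points, and the
  -- boxed conjuncts forbid the relation in either direction.
  obtain ⟨w, hxw, hwz, hw⟩ := hR x y₁ y₂ z hx₁ hx₂ hxz (by rintro rfl; exact hB₁ hB₂)
    (fun h ↦ hn₁ _ h hB₂) (fun h ↦ hn₂ _ h hA₁)
  rcases hw with hw | hw
  · exact Or.inl ⟨w, hxw, ⟨y₁, hw, hA₁⟩, z, hwz, hz⟩
  · exact Or.inr ⟨w, hxw, ⟨y₂, hw, hB₂⟩, z, hwz, hz⟩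

theorem logicD4da2_subset_frameLogic (htrans : ∀ x y z, R x y → R y z → R x z)
    (hserial : ∀ x, ∃ y, R x y) (hdense : ∀ x y, R x y → ∃ z, R x z ∧ R z y)
    (hR : IsAfter2Frame R) : logicD4da2 AP ⊆ frameLogic AP R := by
  refine normalLogic_subset_frameLogic ?_
  rintro φ (((⟨A, rfl⟩ | rfl) | ⟨A, rfl⟩) | ⟨A, B, C, rfl⟩)
  · intro V x
    simp only [ax4, sat_imp, sat_dia]
    rintro ⟨y, hxy, z, hyz, hz⟩
    exact ⟨z, htrans _ _ _ hxy hyz, hz⟩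
  · intro V x
    obtain ⟨y, hy⟩ := hserial x
    exact sat_dia.2 ⟨y, hy, trivial⟩
  · intro V x
    simp only [axDense, sat_imp, sat_dia]
    rintro ⟨y, hxy, hy⟩
    obtain ⟨z, hxz, hzy⟩ := hdense _ _ hxy
    exact ⟨z, hxz, y, hzy, hy⟩
  · exact validOn_after2 hR A B C

end ModalFormula

/-! ### Restriction and concatenation of causal curves -/

namespace Spacetime

variable {d : ℕ} {M : Type*} [TopologicalSpace M]
    [ChartedSpace (EuclideanSpace ℝ (Fin d)) M] [IsManifold (𝓡 d) ∞ M]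

/-- The velocity at `s` of a curve on `[a, b]`, one-sided at the end points. -/
abbrev velocity (d : ℕ) {M : Type*} [TopologicalSpace M]
    [ChartedSpace (EuclideanSpace ℝ (Fin d)) M] (γ : ℝ → M) (a b s : ℝ) : TangentSpace (𝓡 d) (γ s) :=
  mfderivWithin 𝓘(ℝ, ℝ) (𝓡 d) γ (Icc a b) s (1 : ℝ)

/-- The velocity of a curve as a point of the tangent bundle. -/
def velocityLift (d : ℕ) {M : Type*} [TopologicalSpace M]
    [ChartedSpace (EuclideanSpace ℝ (Fin d)) M] (γ : ℝ → M) (a b s : ℝ) :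
    TangentBundle (𝓡 d) M :=
  ⟨γ s, velocity d γ a b s⟩

theorem uniqueMDiffWithinAt_Icc {a b s : ℝ} (hab : a < b) (hs : s ∈ Icc a b) :
    UniqueMDiffWithinAt 𝓘(ℝ, ℝ) (Icc a b) s :=
  (uniqueDiffOn_Icc hab s hs).uniqueMDiffWithinAt

omit [IsManifold (𝓡 d) ∞ M] in
theorem velocity_subinterval {γ : ℝ → M} {a b a' b' s : ℝ}
    (hγ : ContMDiffOn 𝓘(ℝ, ℝ) (𝓡 d) ∞ γ (Icc a b)) (ha : a ≤ a') (hb : b' ≤ b) (hab : a' < b')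
    (hs : s ∈ Icc a' b') : velocity d γ a' b' s = velocity d γ a b s := by
  have hsub := Icc_subset_Icc ha hb
  rw [velocity, mfderivWithin_subset hsub (uniqueMDiffWithinAt_Icc hab hs)
    ((hγ.mdifferentiableOn (by simp)) s (hsub hs))]

variable (S : Spacetime d M)

theorem IsSmoothCausalOn.mono {S : Spacetime d M} {γ : ℝ → M} {a b a' b' : ℝ}
    (hγ : S.IsSmoothCausalOn γ a b) (ha : a ≤ a') (hb : b' ≤ b) (hab : a' < b') :
    S.IsSmoothCausalOn γ a' b' := by
  have hsub := Icc_subset_Icc ha hb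
  refine ⟨hγ.1.mono hsub, fun s hs ↦ ?_⟩
  have := hγ.2 s (hsub hs)
  rw [← velocity, velocity_subinterval hγ.1 ha hb hab hs]
  exact this

theorem IsSmoothCausalOn.congr {S : Spacetime d M} {γ γ' : ℝ → M} {a b : ℝ}
    (hγ : S.IsSmoothCausalOn γ a b) (h : ∀ s ∈ Icc a b, γ' s = γ s) :
    S.IsSmoothCausalOn γ' a b := by
  refine ⟨hγ.1.congr h, fun s hs ↦ ?_⟩
  have h1 := hγ.2 s hs
  rw [mfderivWithin_congr_of_mem h hs]
  rw [h s hs]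
  exact h1

theorem IsSmoothCausalOn.shift {S : Spacetime d M} {γ : ℝ → M} {a b : ℝ}
    (hγ : S.IsSmoothCausalOn γ a b) (hab : a < b) (r : ℝ) :
    S.IsSmoothCausalOn (fun s ↦ γ (s - r)) (a + r) (b + r) := by
  have hmaps : MapsTo (fun s : ℝ ↦ s - r) (Icc (a + r) (b + r)) (Icc a b) := by
    intro s hs; constructor <;> linarith [hs.1, hs.2]
  have hsm : ContMDiff 𝓘(ℝ, ℝ) 𝓘(ℝ, ℝ) ∞ (fun s : ℝ ↦ s - r) :=
    (contDiff_id.sub contDiff_const).contMDiff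
  refine ⟨hγ.1.comp hsm.contMDiffOn hmaps, fun s hs ↦ ?_⟩
  have hu := uniqueMDiffWithinAt_Icc (by linarith : a + r < b + r) hs
  have h1 : mfderivWithin 𝓘(ℝ, ℝ) (𝓡 d) (fun s ↦ γ (s - r)) (Icc (a + r) (b + r)) s (1 : ℝ)
      = mfderivWithin 𝓘(ℝ, ℝ) (𝓡 d) γ (Icc a b) (s - r) (1 : ℝ) := by
    have h2 := mfderivWithin_comp (I := 𝓘(ℝ, ℝ)) (I' := 𝓘(ℝ, ℝ)) (I'' := 𝓡 d) s
      (g := γ) (f := fun s : ℝ ↦ s - r) (s := Icc (a + r) (b + r)) (u := Icc a b)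
      ((hγ.1.mdifferentiableOn (by simp)) _ (hmaps hs))
      ((hsm.mdifferentiable (by simp)) s).mdifferentiableWithinAt hmaps hu
    have h3 : mfderivWithin 𝓘(ℝ, ℝ) 𝓘(ℝ, ℝ) (fun s : ℝ ↦ s - r) (Icc (a + r) (b + r)) s (1 : ℝ)
        = (1 : ℝ) := by
      rw [mfderivWithin_eq_fderivWithin]
      have : HasFDerivWithinAt (fun s : ℝ ↦ s - r) (ContinuousLinearMap.id ℝ ℝ)
        (Icc (a + r) (b + r)) s := ((hasFDerivAt_id s).sub_const r).hasFDerivWithinAt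
      rw [this.fderivWithin hu.uniqueDiffWithinAt]
      rfl
    have h4 := congrArg (fun f ↦ f (1 : ℝ)) h2
    simp only [Function.comp_def] at h4
    exact h4.trans (congrArg (mfderivWithin 𝓘(ℝ, ℝ) (𝓡 d) γ (Icc a b) (s - r)) h3)
  rw [h1]
  exact hγ.2 (s - r) (hmaps hs)

/-- `x` and `y` are joined by a single smooth causal curve. -/
def SmoothAfter (x y : M) : Prop :=
  ∃ (γ : ℝ → M) (a b : ℝ), a < b ∧ S.IsSmoothCausalOn γ a b ∧ γ a = x ∧ γ b = y

variable {S}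

theorem SmoothAfter.after {x y : M} (h : S.SmoothAfter x y) : S.After x y := by
  obtain ⟨γ, a, b, hab, hγ, rfl, rfl⟩ := h
  refine ⟨γ, a, b, ⟨hab, hγ.1.continuousOn, 1, fun i ↦ if i = 0 then a else b, by simp, by simp,
    ?_⟩, rfl, rfl⟩
  intro i hi
  obtain rfl : i = 0 := by omega
  simpa using ⟨hab, hγ⟩

theorem After.trans_smoothAfter {x y z : M} (h₁ : S.After x y) (h₂ : S.SmoothAfter y z) :
    S.After x z := by
  obtain ⟨γ, a, b, ⟨hab, hc, k, t, h0, hk, ht⟩, rfl, rfl⟩ := h₁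
  obtain ⟨η, a', b', hab', hη, hηa, rfl⟩ := h₂
  set c := b' + (b - a') with hcdef
  have hη' : S.IsSmoothCausalOn (fun s ↦ η (s - (b - a'))) b c := by
    have := hη.shift hab' (b - a')
    rwa [show a' + (b - a') = b by ring] at this
  have hbc : b < c := by rw [hcdef]; linarith
  set γ' : ℝ → M := fun s ↦ if s ≤ b then γ s else η (s - (b - a')) with hγ'
  have hl : ∀ s ≤ b, γ' s = γ s := fun s hs ↦ by simp [hγ', hs]
  have hr : ∀ s, b ≤ s → γ' s = η (s - (b - a')) := by
    intro s hs
    rcases hs.eq_or_lt with rfl | hs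
    · rw [hl _ le_rfl, ← hηa]; congr 1; ring
    · simp [hγ', not_le.2 hs]
  -- The old partition points do not exceed `b`, so the glued curve is `γ` on every old piece.
  -- Downward induction from `k`, because `t` is arbitrary beyond that index.
  have htb : ∀ i ≤ k, t i ≤ b := by
    have hmono : ∀ j, ∀ i, i + j = k → t i ≤ b := by
      intro j
      induction j with
      | zero => intro i hi; simp at hi; rw [hi, hk]
      | succ j ih => intro i hi; exact (ht i (by omega)).1.le.trans (ih (i + 1) (by omega))
    exact fun i hi ↦ hmono (k - i) i (by omega)
  refine ⟨γ', a, c, ⟨hab.trans hbc, ?_, k + 1, fun i ↦ if i ≤ k then t i else c, by simp [h0],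
    by simp, ?_⟩, hl _ hab.le, ?_⟩
  · rw [← Icc_union_Icc_eq_Icc hab.le hbc.le]
    refine ContinuousOn.union_of_isClosed ?_ ?_ isClosed_Icc isClosed_Icc
    · exact hc.congr fun s hs ↦ hl s hs.2
    · exact hη'.1.continuousOn.congr fun s hs ↦ hr s hs.1
  · intro i hi
    rcases Nat.lt_succ_iff_lt_or_eq.1 hi with hi | rfl
    · simp only [hi.le, if_true, Nat.succ_le_of_lt hi]
      exact ⟨(ht i hi).1, (ht i hi).2.congr fun s hs ↦ hl s (hs.2.trans (htb _ hi))⟩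
    · simp only [le_refl, if_true, hk, show ¬ (i + 1 ≤ i) by omega, if_false]
      exact ⟨hbc, hη'.congr fun s hs ↦ hr s hs.1⟩
  · rw [hr _ hbc.le, hcdef]; congr 1; ring

/-- Replaces partitions by induction over smooth pieces. A partition with `k = 0` is excluded by `a
< b`, hence the transitive and not the reflexive closure. -/
theorem after_iff_transGen {x y : M} : S.After x y ↔ Relation.TransGen S.SmoothAfter x y := by
  constructor
  · rintro ⟨γ, a, b, ⟨hab, hc, k, t, h0, hk, ht⟩, rfl, rfl⟩
    have key : ∀ j < k, Relation.TransGen S.SmoothAfter (γ (t 0)) (γ (t (j + 1))) := by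
      intro j
      induction j with
      | zero => exact fun hj ↦ .single ⟨γ, _, _, (ht 0 hj).1, (ht 0 hj).2, rfl, rfl⟩
      | succ j ih =>
        exact fun hj ↦ (ih (by omega)).tail ⟨γ, _, _, (ht _ hj).1, (ht _ hj).2, rfl, rfl⟩
    rcases k with _ | k
    · rw [h0] at hk; exact absurd hk hab.ne
    · rw [← h0, ← hk]; exact key k (by omega)
  · intro h
    induction h with
    | single h => exact h.after
    | tail _ h ih => exact ih.trans_smoothAfter h

theorem After.trans {x y z : M} (h₁ : S.After x y) (h₂ : S.After y z) : S.After x z := by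
  rw [after_iff_transGen] at *
  exact h₁.trans h₂

theorem IsSmoothCausalOn.after {γ : ℝ → M} {a b s t : ℝ} (hγ : S.IsSmoothCausalOn γ a b)
    (hs : a ≤ s) (hst : s < t) (ht : t ≤ b) : S.After (γ s) (γ t) :=
  SmoothAfter.after ⟨γ, s, t, hst, hγ.mono hs ht hst, rfl, rfl⟩

/-- A causal curve starts with a smooth piece. -/
theorem After.exists_smooth_start {x y : M} (h : S.After x y) :
    ∃ (γ : ℝ → M) (a b : ℝ), a < b ∧ S.IsSmoothCausalOn γ a b ∧ γ a = x ∧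
      (γ b = y ∨ S.After (γ b) y) := by
  rw [after_iff_transGen, Relation.TransGen.head'_iff] at h
  obtain ⟨z, ⟨γ, a, b, hab, hγ, hx, rfl⟩, hz⟩ := h
  refine ⟨γ, a, b, hab, hγ, hx, ?_⟩
  rw [after_iff_transGen]
  exact (Relation.reflTransGen_iff_eq_or_transGen.1 hz).imp Eq.symm id

theorem After.exists_between {x y : M} (h : S.After x y) : ∃ z, S.After x z ∧ S.After z y := by
  obtain ⟨γ, a, b, hab, hγ, rfl, hy⟩ := h.exists_smooth_start
  obtain ⟨s, hs⟩ := _root_.exists_between hab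
  refine ⟨γ s, hγ.after le_rfl hs.1 hs.2.le, ?_⟩
  have h1 := hγ.after hs.1.le hs.2 le_rfl
  rcases hy with rfl | hy
  · exact h1
  · exact h1.trans hy

end Spacetime

/-! ### Metric, time orientation and causal curves in a chart -/

namespace Spacetime

variable {d : ℕ} {M : Type*} [TopologicalSpace M]
    [ChartedSpace (EuclideanSpace ℝ (Fin d)) M] [IsManifold (𝓡 d) ∞ M]

local notation "𝔼" => EuclideanSpace ℝ (Fin d)

/-- The components of tangent vectors at `x` in the chart at `x₀`. -/
def toChart (x₀ x : M) : TangentSpace (𝓡 d) x →L[ℝ] EuclideanSpace ℝ (Fin d) :=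
  (trivializationAt (EuclideanSpace ℝ (Fin d)) (TangentSpace (𝓡 d)) x₀).continuousLinearMapAt ℝ x

/-- The tangent vector at `x` with given components in the chart at `x₀`. -/
def ofChart (x₀ x : M) : EuclideanSpace ℝ (Fin d) →L[ℝ] TangentSpace (𝓡 d) x :=
  (trivializationAt (EuclideanSpace ℝ (Fin d)) (TangentSpace (𝓡 d)) x₀).symmL ℝ x

theorem ofChart_toChart {x₀ x : M} (hx : x ∈ (chartAt 𝔼 x₀).source)
    (v : TangentSpace (𝓡 d) x) : ofChart x₀ x (toChart x₀ x v) = v :=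
  (trivializationAt 𝔼 (TangentSpace (𝓡 d)) x₀).symmL_continuousLinearMapAt (by simpa using hx) v

theorem toChart_ofChart {x₀ x : M} (hx : x ∈ (chartAt 𝔼 x₀).source)
    (v : 𝔼) : toChart x₀ x (ofChart x₀ x v) = v :=
  (trivializationAt 𝔼 (TangentSpace (𝓡 d)) x₀).continuousLinearMapAt_symmL (by simpa using hx) v

variable (S : Spacetime d M)

/-- The metric in the chart at `x₀`. -/
def chartMetric (x₀ : M) (p : EuclideanSpace ℝ (Fin d)) :
    EuclideanSpace ℝ (Fin d) →L[ℝ] EuclideanSpace ℝ (Fin d) →L[ℝ] ℝ :=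
  ContinuousLinearMap.inCoordinates (EuclideanSpace ℝ (Fin d)) (TangentSpace (𝓡 d))
    (EuclideanSpace ℝ (Fin d) →L[ℝ] ℝ) (fun x : M ↦ TangentSpace (𝓡 d) x →L[ℝ] ℝ) x₀
    ((extChartAt (𝓡 d) x₀).symm p) x₀ ((extChartAt (𝓡 d) x₀).symm p)
    (S.g ((extChartAt (𝓡 d) x₀).symm p))

/-- The time orientation in the chart at `x₀`. -/
def chartTime (x₀ : M) (p : EuclideanSpace ℝ (Fin d)) : EuclideanSpace ℝ (Fin d) :=
  toChart x₀ ((extChartAt (𝓡 d) x₀).symm p) (S.T ((extChartAt (𝓡 d) x₀).symm p))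

variable {S} {x₀ : M}

theorem chartMetric_apply {x : M} (hx : x ∈ (chartAt 𝔼 x₀).source) (v w : 𝔼) :
    S.chartMetric x₀ (extChartAt (𝓡 d) x₀ x) v w = S.g x (ofChart x₀ x v) (ofChart x₀ x w) := by
  have h : (extChartAt (𝓡 d) x₀).symm (extChartAt (𝓡 d) x₀ x) = x :=
    (extChartAt (𝓡 d) x₀).left_inv (by simpa using hx)
  have hb : x ∈ (trivializationAt 𝔼 (TangentSpace (𝓡 d)) x₀).baseSet := by simpa using hx
  rw [chartMetric, h, inCoordinates_apply_eq₂ hb hb (mem_univ _)]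
  simp only [Trivial.fiberBundle_trivializationAt', Trivial.linearMapAt_trivialization,
    LinearMap.id_coe, id_eq]
  rw [ofChart, Trivialization.symmL_apply _ hb, Trivialization.symmL_apply _ hb]

theorem chartMetric_toChart {x : M} (hx : x ∈ (chartAt 𝔼 x₀).source)
    (v w : TangentSpace (𝓡 d) x) :
    S.chartMetric x₀ (extChartAt (𝓡 d) x₀ x) (toChart x₀ x v) (toChart x₀ x w) = S.g x v w := by
  rw [chartMetric_apply hx, ofChart_toChart hx, ofChart_toChart hx]

theorem chartTime_apply {x : M} (hx : x ∈ (chartAt 𝔼 x₀).source) :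
    S.chartTime x₀ (extChartAt (𝓡 d) x₀ x) = toChart x₀ x (S.T x) := by
  have h : (extChartAt (𝓡 d) x₀).symm (extChartAt (𝓡 d) x₀ x) = x :=
    (extChartAt (𝓡 d) x₀).left_inv (by simpa using hx)
  rw [chartTime, h]

/-- Regularity at the centre of the chart is enough: each local argument uses the chart centred at
the point under study. -/
theorem contDiffAt_chartMetric (S : Spacetime d M) (x₀ : M) :
    ContDiffAt ℝ ∞ (S.chartMetric x₀) (extChartAt (𝓡 d) x₀ x₀) := by
  have h1 := ((contMDiffAt_hom_bundle _).1 (S.smooth_g x₀)).2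
  have h2 := (contMDiffOn_extChartAt_symm (I := 𝓡 d) (n := ∞) x₀).contMDiffAt
    ((isOpen_extChartAt_target x₀).mem_nhds (mem_extChartAt_target x₀))
  rw [← extChartAt_to_inv (I := 𝓡 d) x₀] at h1
  have h3 := (h1.comp (extChartAt (𝓡 d) x₀ x₀) h2).contDiffAt
  refine h3.congr_of_eventuallyEq (Filter.Eventually.of_forall fun p ↦ ?_)
  simp only [Function.comp, extChartAt_to_inv, chartMetric]

theorem continuousAt_chartTime (S : Spacetime d M) (x₀ : M) :
    ContinuousAt (S.chartTime x₀) (extChartAt (𝓡 d) x₀ x₀) := by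
  have h1 := S.continuous_T.continuousAt (x := x₀)
  rw [FiberBundle.continuousAt_totalSpace] at h1
  have h2 := continuousAt_extChartAt_symm (I := 𝓡 d) x₀
  have h1' := h1.2
  rw [← extChartAt_to_inv (I := 𝓡 d) x₀] at h1'
  have h3 := ContinuousAt.comp (f := (extChartAt (𝓡 d) x₀).symm) h1' h2
  refine h3.congr ?_
  filter_upwards [extChartAt_target_mem_nhds (I := 𝓡 d) x₀] with p hp
  have hb : (extChartAt (𝓡 d) x₀).symm p ∈
      (trivializationAt 𝔼 (TangentSpace (𝓡 d)) x₀).baseSet := by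
    simpa using (extChartAt (𝓡 d) x₀).map_target hp
  simp only [Function.comp, extChartAt_to_inv, chartTime, toChart]
  rw [Trivialization.continuousLinearMapAt_apply, Trivialization.coe_linearMapAt_of_mem _ hb]

omit [IsManifold (𝓡 d) ∞ M] in
theorem extChartAt_source_eq (x₀ : M) :
    (extChartAt (𝓡 d) x₀).source = (chartAt 𝔼 x₀).source := by simp

theorem contDiffOn_chart_comp {γ : ℝ → M} {a b : ℝ}
    (hγ : ContMDiffOn 𝓘(ℝ, ℝ) (𝓡 d) ∞ γ (Icc a b))
    (hs : ∀ s ∈ Icc a b, γ s ∈ (chartAt 𝔼 x₀).source) :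
    ContDiffOn ℝ ∞ (fun s ↦ extChartAt (𝓡 d) x₀ (γ s)) (Icc a b) :=
  ((contMDiffOn_extChartAt (I := 𝓡 d) (n := ∞) (x := x₀)).comp hγ hs).contDiffOn

theorem derivWithin_chart_comp {γ : ℝ → M} {a b : ℝ} (hab : a < b)
    (hγ : ContMDiffOn 𝓘(ℝ, ℝ) (𝓡 d) ∞ γ (Icc a b))
    {s : ℝ} (hs : s ∈ Icc a b) (hx : γ s ∈ (chartAt 𝔼 x₀).source) :
    derivWithin (fun s ↦ extChartAt (𝓡 d) x₀ (γ s)) (Icc a b) s =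
      toChart x₀ (γ s) (velocity d γ a b s) := by
  have h2 := mfderiv_comp_mfderivWithin (I := 𝓘(ℝ, ℝ)) (I' := 𝓡 d) (I'' := 𝓘(ℝ, 𝔼)) s
      (g := extChartAt (𝓡 d) x₀) (f := γ) (s := Icc a b)
      (mdifferentiableAt_extChartAt hx)
      ((hγ.mdifferentiableOn (by simp)) s hs) (uniqueMDiffWithinAt_Icc hab hs)
  have h4 := congrArg (fun f ↦ f (1 : ℝ)) h2
  rw [mfderivWithin_eq_fderivWithin] at h4
  rw [toChart, TangentBundle.continuousLinearMapAt_trivializationAt hx]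
  exact h4

/-- Future directed causal vectors in a chart. -/
def ChartFuture (S : Spacetime d M) (x₀ : M) (p v : EuclideanSpace ℝ (Fin d)) : Prop :=
  S.chartMetric x₀ p v v ≤ 0 ∧ S.chartMetric x₀ p (S.chartTime x₀ p) v < 0

/-- The condition `v ≠ 0` disappears on the left because a vector with negative product with the
time orientation is nonzero. -/
theorem chartFuture_toChart_iff {x : M} (hx : x ∈ (chartAt 𝔼 x₀).source)
    (v : TangentSpace (𝓡 d) x) :
    S.ChartFuture x₀ (extChartAt (𝓡 d) x₀ x) (toChart x₀ x v) ↔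
      S.IsCausal v ∧ S.IsFutureDirected v := by
  rw [ChartFuture, chartTime_apply hx, chartMetric_toChart hx, chartMetric_toChart hx, IsCausal,
    IsFutureDirected]
  constructor
  · rintro ⟨h1, h2⟩
    refine ⟨⟨?_, h1⟩, h2⟩
    rintro rfl
    simp at h2
  · rintro ⟨⟨-, h1⟩, h2⟩
    exact ⟨h1, h2⟩

theorem IsSmoothCausalOn.chartFuture {γ : ℝ → M} {a b : ℝ} (hab : a < b)
    (hγ : S.IsSmoothCausalOn γ a b) {s : ℝ} (hs : s ∈ Icc a b)
    (hx : γ s ∈ (chartAt 𝔼 x₀).source) :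
    S.ChartFuture x₀ (extChartAt (𝓡 d) x₀ (γ s))
      (derivWithin (fun s ↦ extChartAt (𝓡 d) x₀ (γ s)) (Icc a b) s) := by
  rw [derivWithin_chart_comp hab hγ.1 hs hx, chartFuture_toChart_iff hx]
  exact hγ.2 s hs

theorem isSmoothCausalOn_of_chart {c : ℝ → EuclideanSpace ℝ (Fin d)} {a b : ℝ} (hab : a < b)
    (hc : ContDiffOn ℝ ∞ c (Icc a b)) (ht : ∀ s ∈ Icc a b, c s ∈ (extChartAt (𝓡 d) x₀).target)
    (hf : ∀ s ∈ Icc a b, S.ChartFuture x₀ (c s) (derivWithin c (Icc a b) s)) :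
    S.IsSmoothCausalOn (fun s ↦ (extChartAt (𝓡 d) x₀).symm (c s)) a b := by
  have hsm : ContMDiffOn 𝓘(ℝ, ℝ) (𝓡 d) ∞ (fun s ↦ (extChartAt (𝓡 d) x₀).symm (c s)) (Icc a b) :=
    (contMDiffOn_extChartAt_symm (I := 𝓡 d) (n := ∞) x₀).comp hc.contMDiffOn ht
  refine ⟨hsm, fun s hs ↦ ?_⟩
  have hx : (extChartAt (𝓡 d) x₀).symm (c s) ∈ (chartAt 𝔼 x₀).source := by
    simpa using (extChartAt (𝓡 d) x₀).map_target (ht s hs)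
  rw [← chartFuture_toChart_iff hx, ← velocity, ← derivWithin_chart_comp hab hsm hs hx]
  have heq : ∀ s ∈ Icc a b,
      extChartAt (𝓡 d) x₀ ((extChartAt (𝓡 d) x₀).symm (c s)) = c s :=
    fun s hs ↦ (extChartAt (𝓡 d) x₀).right_inv (ht s hs)
  rw [heq s hs, derivWithin_congr heq (heq s hs)]
  exact hf s hs

end Spacetime

/-! ### Chronological pasts, timelike velocities and corners -/

namespace Spacetime

variable {d : ℕ} {M : Type*} [TopologicalSpace M]
    [ChartedSpace (EuclideanSpace ℝ (Fin d)) M] [IsManifold (𝓡 d) ∞ M]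
    {S : Spacetime d M} {x₀ : M}

local notation "𝔼" => EuclideanSpace ℝ (Fin d)

open Filter Topology

theorem g_symm (x : M) (v w : TangentSpace (𝓡 d) x) : S.g x v w = S.g x w v := by
  obtain ⟨b, i₀, hb⟩ := S.lorentzian x
  rw [← b.sum_repr v, ← b.sum_repr w]
  simp only [map_sum, map_smul, _root_.sum_apply, _root_.smul_apply, hb, smul_eq_mul,
    Finset.mul_sum]
  rw [Finset.sum_comm]
  refine Finset.sum_congr rfl fun i _ ↦ Finset.sum_congr rfl fun j _ ↦ ?_
  by_cases h : i = j
  · subst h; ring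
  · rw [if_neg h, if_neg (Ne.symm h)]; ring

theorem chartMetric_symm {p : 𝔼} (hp : p ∈ (extChartAt (𝓡 d) x₀).target) (v w : 𝔼) :
    S.chartMetric x₀ p v w = S.chartMetric x₀ p w v := by
  have hx : (extChartAt (𝓡 d) x₀).symm p ∈ (chartAt 𝔼 x₀).source := by
    simpa using (extChartAt (𝓡 d) x₀).map_target hp
  rw [← (extChartAt (𝓡 d) x₀).right_inv hp, chartMetric_apply hx, chartMetric_apply hx, g_symm]

/-- The chronological past of `y`, described as the interior of its causal past. -/
def past (S : Spacetime d M) (y : M) : Set M := interior {w | S.After w y}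

theorem after_of_mem_past {x y : M} (h : x ∈ S.past y) : S.After x y :=
  interior_subset (s := {w | S.After w y}) h

theorem past_subset_past {y z : M} (h : S.After y z) : S.past y ⊆ S.past z :=
  interior_mono fun _ hw ↦ After.trans hw h

theorem continuousAt_chartMetric (S : Spacetime d M) (x₀ : M) :
    ContinuousAt (S.chartMetric x₀) (extChartAt (𝓡 d) x₀ x₀) :=
  (contDiffAt_chartMetric S x₀).continuousAt

theorem continuousAt_chartMetric_apply {X : Type*} [TopologicalSpace X] {t : X}
    {p v w : X → 𝔼} (hpt : p t = extChartAt (𝓡 d) x₀ x₀)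
    (hp : ContinuousAt p t) (hv : ContinuousAt v t) (hw : ContinuousAt w t) :
    ContinuousAt (fun s ↦ S.chartMetric x₀ (p s) (v s) (w s)) t := by
  have h : ContinuousAt (fun s ↦ S.chartMetric x₀ (p s)) t :=
    ContinuousAt.comp (g := S.chartMetric x₀) (by rw [hpt]; exact continuousAt_chartMetric S x₀) hp
  exact (h.clm_apply hv).clm_apply hw

theorem continuousAt_chartTime_comp {X : Type*} [TopologicalSpace X] {t : X}
    {p : X → 𝔼} (hpt : p t = extChartAt (𝓡 d) x₀ x₀) (hp : ContinuousAt p t) :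
    ContinuousAt (fun s ↦ S.chartTime x₀ (p s)) t :=
  ContinuousAt.comp (g := S.chartTime x₀) (by rw [hpt]; exact continuousAt_chartTime S x₀) hp

/-- Short straight segments in a timelike direction are causal. -/
theorem exists_segment_after {v₀ : 𝔼}
    (h₁ : S.chartMetric x₀ (extChartAt (𝓡 d) x₀ x₀) v₀ v₀ < 0)
    (h₂ : S.chartMetric x₀ (extChartAt (𝓡 d) x₀ x₀)
      (S.chartTime x₀ (extChartAt (𝓡 d) x₀ x₀)) v₀ < 0) :
    ∃ δ > 0, ∀ p v : 𝔼, ∀ h : ℝ, dist p (extChartAt (𝓡 d) x₀ x₀) < δ → dist v v₀ < δ →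
      0 < h → h < δ →
      S.After ((extChartAt (𝓡 d) x₀).symm p) ((extChartAt (𝓡 d) x₀).symm (p + h • v)) := by
  set p₀ := extChartAt (𝓡 d) x₀ x₀ with hp₀
  -- Causality of the velocity `v` at `p + s • v` is implied by open conditions on `(p, v, s)` that
  -- hold at `(p₀, v₀, 0)`. Hence one `δ` serves all nearby starting points, directions and lengths.
  have hP : ContinuousAt (fun q : 𝔼 × 𝔼 × ℝ ↦ q.1 + q.2.2 • q.2.1) (p₀, v₀, 0) := by fun_prop
  have hPt : (fun q : 𝔼 × 𝔼 × ℝ ↦ q.1 + q.2.2 • q.2.1) (p₀, v₀, 0) = p₀ := by simp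
  have hV : ContinuousAt (fun q : 𝔼 × 𝔼 × ℝ ↦ q.2.1) (p₀, v₀, 0) := by fun_prop
  have e1 : ∀ᶠ q in 𝓝 (p₀, v₀, (0 : ℝ)), S.chartMetric x₀ (q.1 + q.2.2 • q.2.1) q.2.1 q.2.1 < 0 :=
    (continuousAt_chartMetric_apply (S := S) (p := fun q : 𝔼 × 𝔼 × ℝ ↦ q.1 + q.2.2 • q.2.1)
      hPt hP hV hV).eventually_lt continuousAt_const (by simpa using h₁)
  have e2 : ∀ᶠ q in 𝓝 (p₀, v₀, (0 : ℝ)), S.chartMetric x₀ (q.1 + q.2.2 • q.2.1)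
      (S.chartTime x₀ (q.1 + q.2.2 • q.2.1)) q.2.1 < 0 :=
    (continuousAt_chartMetric_apply (S := S) (p := fun q : 𝔼 × 𝔼 × ℝ ↦ q.1 + q.2.2 • q.2.1)
      hPt hP (continuousAt_chartTime_comp (S := S) hPt hP) hV).eventually_lt continuousAt_const (by simpa using h₂)
  have e3 : ∀ᶠ q in 𝓝 (p₀, v₀, (0 : ℝ)), q.1 + q.2.2 • q.2.1 ∈ (extChartAt (𝓡 d) x₀).target :=
    hP (by rw [hPt]; exact extChartAt_target_mem_nhds x₀)
  obtain ⟨δ, hδ, H⟩ := Metric.eventually_nhds_iff.1 (e1.and (e2.and e3))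
  refine ⟨δ, hδ, fun p v h hp hv h0 hh ↦ ?_⟩
  have H' : ∀ s ∈ Icc 0 h, _ := fun s hs ↦ H (y := (p, v, s)) (by
    simp only [Prod.dist_eq, max_lt_iff]
    refine ⟨hp, hv, ?_⟩
    rw [Real.dist_eq, sub_zero, abs_of_nonneg hs.1]
    exact hs.2.trans_lt hh)
  have hd : ∀ s ∈ Icc 0 h, derivWithin (fun s : ℝ ↦ p + s • v) (Icc 0 h) s = v := by
    intro s hs
    have : HasDerivWithinAt (fun s : ℝ ↦ p + s • v) ((1 : ℝ) • v) (Icc 0 h) s :=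
      ((hasDerivWithinAt_id s _).smul_const v).const_add p
    rw [this.derivWithin (uniqueDiffOn_Icc h0 s hs), one_smul]
  have hc : S.IsSmoothCausalOn (fun s ↦ (extChartAt (𝓡 d) x₀).symm (p + s • v)) 0 h := by
    refine isSmoothCausalOn_of_chart h0 ?_ (fun s hs ↦ (H' s hs).2.2) fun s hs ↦ ?_
    · fun_prop
    · rw [hd s hs]
      exact ⟨(H' s hs).1.le, (H' s hs).2.1⟩
  simpa using hc.after le_rfl h0 le_rfl

/-- If two points `p h` and `r h` near `x₀` differ by a timelike vector to first order, then one is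
in the chronological past of the other. -/
theorem eventually_mem_past {v₀ : 𝔼}
    (h₁ : S.chartMetric x₀ (extChartAt (𝓡 d) x₀ x₀) v₀ v₀ < 0)
    (h₂ : S.chartMetric x₀ (extChartAt (𝓡 d) x₀ x₀)
      (S.chartTime x₀ (extChartAt (𝓡 d) x₀ x₀)) v₀ < 0)
    {p r : ℝ → 𝔼} (hp : Tendsto p (𝓝[>] 0) (𝓝 (extChartAt (𝓡 d) x₀ x₀)))
    (hr : Tendsto (fun h : ℝ ↦ h⁻¹ • (r h - p h)) (𝓝[>] 0) (𝓝 v₀)) :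
    ∀ᶠ h in 𝓝[>] 0,
      (extChartAt (𝓡 d) x₀).symm (p h) ∈ S.past ((extChartAt (𝓡 d) x₀).symm (r h)) := by
  obtain ⟨δ, hδ, H⟩ := exists_segment_after h₁ h₂
  filter_upwards [hp.eventually_mem (Metric.ball_mem_nhds _ hδ),
    hr.eventually_mem (Metric.ball_mem_nhds _ hδ), self_mem_nhdsWithin,
    nhdsWithin_le_nhds (Iio_mem_nhds hδ),
    hp.eventually_mem (extChartAt_target_mem_nhds x₀)] with h hph hrh h0 hhδ hpt
  rw [mem_ball_iff_norm, ← dist_eq_norm] at hph hrh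
  have hx : (extChartAt (𝓡 d) x₀).symm (p h) ∈ (extChartAt (𝓡 d) x₀).source :=
    (extChartAt (𝓡 d) x₀).map_target hpt
  have hright : extChartAt (𝓡 d) x₀ ((extChartAt (𝓡 d) x₀).symm (p h)) = p h :=
    (extChartAt (𝓡 d) x₀).right_inv hpt
  have hcont : ContinuousAt (extChartAt (𝓡 d) x₀) ((extChartAt (𝓡 d) x₀).symm (p h)) :=
    continuousAt_extChartAt' hx
  rw [past, mem_interior_iff_mem_nhds]
  -- For fixed `h`, every `w` near the first point reaches the second by the segment of duration `h`
  -- with velocity `h⁻¹ • (r h - w)` in the chart, still close to `v₀`. So a whole neighbourhood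
  -- lies in the causal past.
  have e1 : ∀ᶠ w in 𝓝 ((extChartAt (𝓡 d) x₀).symm (p h)),
      dist (extChartAt (𝓡 d) x₀ w) (extChartAt (𝓡 d) x₀ x₀) < δ :=
    (hcont.dist continuousAt_const).eventually_lt continuousAt_const (by rwa [hright])
  have e2 : ∀ᶠ w in 𝓝 ((extChartAt (𝓡 d) x₀).symm (p h)),
      dist (h⁻¹ • (r h - extChartAt (𝓡 d) x₀ w)) v₀ < δ :=
    ContinuousAt.eventually_lt (f := fun w ↦ dist (h⁻¹ • (r h - extChartAt (𝓡 d) x₀ w)) v₀)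
      (((continuousAt_const.sub hcont).const_smul h⁻¹).dist continuousAt_const)
      continuousAt_const (by rwa [hright])
  filter_upwards [e1, e2, extChartAt_source_mem_nhds' hx] with w hw1 hw2 hw3
  have := H _ _ h hw1 hw2 h0 hhδ
  rw [smul_smul, mul_inv_cancel₀ (ne_of_gt h0), one_smul, add_sub_cancel,
    (extChartAt (𝓡 d) x₀).left_inv hw3] at this
  exact this

omit [IsManifold (𝓡 d) ∞ M] in
theorem exists_subinterval_source {γ : ℝ → M} {a b : ℝ} (hab : a < b)
    (hγ : ContinuousOn γ (Icc a b)) {U : Set M} (hU : U ∈ 𝓝 (γ a)) :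
    ∃ b', a < b' ∧ b' ≤ b ∧ ∀ s ∈ Icc a b', γ s ∈ U := by
  have h : ∀ᶠ s in 𝓝[≥] a, γ s ∈ U := by
    have h1 := (hγ a (left_mem_Icc.2 hab.le)).eventually_mem hU
    rwa [nhdsWithin_Icc_eq_nhdsGE hab] at h1
  obtain ⟨u, hu, hsub⟩ := mem_nhdsGE_iff_exists_Icc_subset.1 h
  exact ⟨min u b, lt_min hu hab, min_le_right _ _,
    fun s hs ↦ hsub ⟨hs.1, hs.2.trans (min_le_left _ _)⟩⟩

theorem hasDerivWithinAt_chart_comp {γ : ℝ → M} {a b s : ℝ} (hab : a < b)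
    (hγ : S.IsSmoothCausalOn γ a b) (hs : s ∈ Icc a b)
    (hx : γ s ∈ (chartAt 𝔼 x₀).source) :
    HasDerivWithinAt (fun s ↦ extChartAt (𝓡 d) x₀ (γ s)) (toChart x₀ (γ s) (velocity d γ a b s))
      (Icc a b) s := by
  rw [← derivWithin_chart_comp hab hγ.1 hs hx]
  have h1 : MDifferentiableWithinAt 𝓘(ℝ, ℝ) 𝓘(ℝ, 𝔼) (fun s ↦ extChartAt (𝓡 d) x₀ (γ s))
      (Icc a b) s :=
    (mdifferentiableAt_extChartAt hx).comp_mdifferentiableWithinAt s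
      ((hγ.1.mdifferentiableOn (by simp)) s hs)
  exact h1.differentiableWithinAt.hasDerivWithinAt

theorem tendsto_quotient_right {E : Type*} [NormedAddCommGroup E] [NormedSpace ℝ E]
    {f : ℝ → E} {f' : E} {a b : ℝ} (hab : a < b)
    (hf : HasDerivWithinAt f f' (Icc a b) a) :
    Tendsto (fun h : ℝ ↦ h⁻¹ • (f (a + h) - f a)) (𝓝[>] 0) (𝓝 f') := by
  have h1 := hasDerivWithinAt_iff_tendsto_slope.1 hf
  have h2 : Tendsto (fun h : ℝ ↦ a + h) (𝓝[>] 0) (𝓝[Icc a b \ {a}] a) := by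
    refine tendsto_nhdsWithin_iff.2 ⟨?_, ?_⟩
    · have : Tendsto (fun h : ℝ ↦ a + h) (𝓝 0) (𝓝 (a + 0)) :=
        tendsto_const_nhds.add tendsto_id
      rw [add_zero] at this
      exact this.mono_left nhdsWithin_le_nhds
    · filter_upwards [Ioo_mem_nhdsGT (sub_pos.2 hab)] with h hh
      exact ⟨⟨by linarith [hh.1], by linarith [hh.2]⟩, by simpa using hh.1.ne'⟩
  refine (h1.comp h2).congr fun h ↦ ?_
  simp [slope]

theorem tendsto_quotient_left {E : Type*} [NormedAddCommGroup E] [NormedSpace ℝ E]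
    {f : ℝ → E} {f' : E} {a b : ℝ} (hab : a < b)
    (hf : HasDerivWithinAt f f' (Icc a b) b) :
    Tendsto (fun h : ℝ ↦ h⁻¹ • (f b - f (b - h))) (𝓝[>] 0) (𝓝 f') := by
  have h1 := hasDerivWithinAt_iff_tendsto_slope.1 hf
  have h2 : Tendsto (fun h : ℝ ↦ b - h) (𝓝[>] 0) (𝓝[Icc a b \ {b}] b) := by
    refine tendsto_nhdsWithin_iff.2 ⟨?_, ?_⟩
    · have : Tendsto (fun h : ℝ ↦ b - h) (𝓝 0) (𝓝 (b - 0)) :=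
        tendsto_const_nhds.sub tendsto_id
      rw [sub_zero] at this
      exact this.mono_left nhdsWithin_le_nhds
    · filter_upwards [Ioo_mem_nhdsGT (sub_pos.2 hab)] with h hh
      exact ⟨⟨by linarith [hh.2], by linarith [hh.1]⟩, by simpa using hh.1.ne'⟩
  refine (h1.comp h2).congr fun h ↦ ?_
  simp only [Function.comp, slope, vsub_eq_sub, sub_sub_cancel_left, inv_neg, neg_smul, ← smul_neg,
    neg_sub]

/-- A causal curve with timelike initial velocity leads into the chronological future. -/
theorem IsSmoothCausalOn.exists_mem_past_of_timelike {γ : ℝ → M} {a b : ℝ} (hab : a < b)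
    (hγ : S.IsSmoothCausalOn γ a b)
    (ht : S.g (γ a) (velocity d γ a b a) (velocity d γ a b a) < 0) :
    ∃ s ∈ Ioc a b, γ a ∈ S.past (γ s) := by
  have ha : a ∈ Icc a b := left_mem_Icc.2 hab.le
  have hx : γ a ∈ (chartAt 𝔼 (γ a)).source := mem_chart_source _ _
  have hd := hasDerivWithinAt_chart_comp hab hγ ha hx
  have hlim := tendsto_quotient_right hab hd
  have hev := eventually_mem_past (S := S) (x₀ := γ a)
    (v₀ := toChart (γ a) (γ a) (velocity d γ a b a))
    (by rwa [chartMetric_toChart hx])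
    (by rw [chartTime_apply hx, chartMetric_toChart hx]; exact (hγ.2 a ha).2)
    (p := fun _ ↦ extChartAt (𝓡 d) (γ a) (γ a))
    (r := fun h ↦ extChartAt (𝓡 d) (γ a) (γ (a + h))) tendsto_const_nhds hlim
  obtain ⟨b', hab', hb', hsrc⟩ := exists_subinterval_source hab hγ.1.continuousOn
    (extChartAt_source_mem_nhds (I := 𝓡 d) (γ a))
  obtain ⟨h, hh, hI⟩ := (hev.and (Ioo_mem_nhdsGT (sub_pos.2 hab'))).exists
  rw [extChartAt_to_inv, (extChartAt (𝓡 d) (γ a)).left_inv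
    (hsrc _ ⟨by linarith [hI.1], by linarith [hI.2]⟩)] at hh
  exact ⟨a + h, ⟨by linarith [hI.1], by linarith [hI.2]⟩, hh⟩

/-- A causal curve with a corner leads into the chronological future. -/
theorem IsSmoothCausalOn.exists_mem_past_of_corner {γ η : ℝ → M} {a b a' b' : ℝ} (hab : a < b)
    (hγ : S.IsSmoothCausalOn γ a b) (hab' : a' < b') (hη : S.IsSmoothCausalOn η a' b')
    {x : M} {v₁ w₁ : TangentSpace (𝓡 d) x} (hv₁ : velocityLift d γ a b b = ⟨x, v₁⟩)
    (hw₁ : velocityLift d η a' b' a' = ⟨x, w₁⟩) (ht : S.g x v₁ w₁ < 0) :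
    ∃ s ∈ Ico a b, ∃ t ∈ Ioc a' b', γ s ∈ S.past (η t) := by
  obtain rfl : γ b = x := congrArg TotalSpace.proj hv₁
  obtain rfl : velocity d γ a b b = v₁ := by simpa [velocityLift] using hv₁
  have h : η a' = γ b := congrArg TotalSpace.proj hw₁
  have hb : b ∈ Icc a b := right_mem_Icc.2 hab.le
  have ha' : a' ∈ Icc a' b' := left_mem_Icc.2 hab'.le
  have hx : γ b ∈ (chartAt 𝔼 (γ b)).source := mem_chart_source _ _
  have hx' : η a' ∈ (chartAt 𝔼 (γ b)).source := by rw [h]; exact hx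
  have hd := hasDerivWithinAt_chart_comp hab hγ hb hx
  have hd' := hasDerivWithinAt_chart_comp hab' hη ha' hx'
  set p₀ := extChartAt (𝓡 d) (γ b) (γ b) with hp₀
  set v := toChart (γ b) (γ b) (velocity d γ a b b) with hv
  set w := toChart (γ b) (η a') (velocity d η a' b' a') with hw
  have hp₀' : extChartAt (𝓡 d) (γ b) (η a') = p₀ := by rw [h]
  have fv := (chartFuture_toChart_iff (S := S) hx _).2 (hγ.2 b hb)
  have fw := (chartFuture_toChart_iff (S := S) hx' _).2 (hη.2 a' ha')
  change S.ChartFuture (γ b) p₀ v at fv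
  change S.ChartFuture (γ b) _ w at fw
  rw [hp₀'] at fw
  have hvw : S.chartMetric (γ b) p₀ v w < 0 := by
    -- The points `η a'` and `γ b` are only propositionally equal, so the velocities are compared as
    -- points of the tangent bundle.
    have h1 : w = toChart (γ b) (γ b) w₁ :=
      congrArg (fun q : TangentBundle (𝓡 d) M ↦ toChart (γ b) q.1 q.2) hw₁
    rw [h1, hv, hp₀, chartMetric_toChart hx]
    exact ht
  have hsym : S.chartMetric (γ b) p₀ w v = S.chartMetric (γ b) p₀ v w :=
    chartMetric_symm (mem_extChartAt_target _) _ _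
  -- The chord that cuts off the corner has limiting direction `v + w`. This is timelike: `v` and
  -- `w` are causal and the cross term `2 g(v, w)` is negative.
  have hlim : Tendsto (fun h : ℝ ↦ h⁻¹ • (extChartAt (𝓡 d) (γ b) (η (a' + h)) -
      extChartAt (𝓡 d) (γ b) (γ (b - h)))) (𝓝[>] 0) (𝓝 (v + w)) := by
    refine ((tendsto_quotient_left hab hd).add (tendsto_quotient_right hab' hd')).congr fun h ↦ ?_
    rw [← smul_add, hp₀', hp₀]
    congr 1
    abel
  have h1 : Tendsto (fun h : ℝ ↦ b - h) (𝓝[>] 0) (𝓝[Icc a b] b) := by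
    refine tendsto_nhdsWithin_iff.2 ⟨?_, ?_⟩
    · have : Tendsto (fun h : ℝ ↦ b - h) (𝓝 0) (𝓝 (b - 0)) :=
        tendsto_const_nhds.sub tendsto_id
      rw [sub_zero] at this
      exact this.mono_left nhdsWithin_le_nhds
    · filter_upwards [Ioo_mem_nhdsGT (sub_pos.2 hab)] with h hh
      exact ⟨by linarith [hh.2], by linarith [hh.1]⟩
  have hpl : Tendsto (fun h : ℝ ↦ extChartAt (𝓡 d) (γ b) (γ (b - h))) (𝓝[>] 0) (𝓝 p₀) := by
    exact hd.continuousWithinAt.tendsto.comp h1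
  have hev := eventually_mem_past (S := S) (x₀ := γ b) (v₀ := v + w)
    (by
      have := fv.1; have := fw.1
      simp only [map_add, _root_.add_apply, ← hp₀, hsym]
      linarith)
    (by
      have := fv.2; have := fw.2
      simp only [map_add, ← hp₀]
      linarith) hpl hlim
  obtain ⟨b₁, hab₁, hb₁, hsrc⟩ := exists_subinterval_source hab' hη.1.continuousOn
    (U := (extChartAt (𝓡 d) (γ b)).source)
    (by rw [h]; exact extChartAt_source_mem_nhds (I := 𝓡 d) (γ b))
  have hev' : ∀ᶠ h in 𝓝[>] 0, γ (b - h) ∈ (extChartAt (𝓡 d) (γ b)).source := by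
    exact ((hγ.1.continuousOn b hb).tendsto.comp h1).eventually_mem
      (extChartAt_source_mem_nhds (I := 𝓡 d) (γ b))
  obtain ⟨h, ⟨hh, hs⟩, hI, hI'⟩ := ((hev.and hev').and
    (inter_mem (Ioo_mem_nhdsGT (sub_pos.2 hab₁)) (Ioo_mem_nhdsGT (sub_pos.2 hab)))).exists
  rw [(extChartAt (𝓡 d) (γ b)).left_inv hs, (extChartAt (𝓡 d) (γ b)).left_inv
    (hsrc _ ⟨by linarith [hI.1], by linarith [hI.2]⟩)] at hh
  exact ⟨b - h, ⟨by linarith [hI'.2], by linarith [hI.1]⟩, a' + h,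
    ⟨by linarith [hI.1], by linarith [hI.2]⟩, hh⟩

end Spacetime

/-! ### Deformation of causal curves and the push-up property -/

namespace Spacetime

variable {d : ℕ} {M : Type*} [TopologicalSpace M]
    [ChartedSpace (EuclideanSpace ℝ (Fin d)) M] [IsManifold (𝓡 d) ∞ M]
    {S : Spacetime d M} {x₀ : M}

local notation "𝔼" => EuclideanSpace ℝ (Fin d)

open Filter Topology

theorem exists_after (S : Spacetime d M) (x : M) : ∃ y, S.After x y := by
  have hx : x ∈ (chartAt 𝔼 x).source := mem_chart_source _ _
  have ht : S.chartMetric x (extChartAt (𝓡 d) x x) (S.chartTime x (extChartAt (𝓡 d) x x))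
      (S.chartTime x (extChartAt (𝓡 d) x x)) < 0 := by
    rw [chartTime_apply hx, chartMetric_toChart hx]
    exact S.timelike_T x
  obtain ⟨δ, hδ, H⟩ := exists_segment_after ht ht
  have := H _ _ (δ / 2) (by rwa [dist_self]) (by rwa [dist_self]) (by linarith) (by linarith)
  rw [extChartAt_to_inv] at this
  exact ⟨_, this⟩

section Deformation

variable {E : Type*} [NormedAddCommGroup E] [NormedSpace ℝ E]

local instance normedAddCommGroupBilin : NormedAddCommGroup (E →L[ℝ] E →L[ℝ] ℝ) :=
  ContinuousLinearMap.toNormedAddCommGroup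

local instance seminormedAddCommGroupBilin : SeminormedAddCommGroup (E →L[ℝ] E →L[ℝ] ℝ) :=
  ContinuousLinearMap.toSeminormedAddCommGroup

local instance seminormedAddGroupBilin : SeminormedAddGroup (E →L[ℝ] E →L[ℝ] ℝ) :=
  ContinuousLinearMap.toSeminormedAddCommGroup.toSeminormedAddGroup

theorem hasDerivAt_push (u V : E) (ε K a s : ℝ) :
    HasDerivAt (fun s : ℝ ↦ u + (ε * (Real.exp (K * (s - a)) - 1)) • V)
      ((ε * (K * Real.exp (K * (s - a)))) • V) s := by
  have h1 : HasDerivAt (fun s : ℝ ↦ K * (s - a)) K s := by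
    simpa using ((hasDerivAt_id s).sub_const a).const_mul K
  have h2 := ((h1.exp.sub_const 1).const_mul ε).smul_const V
  have h3 := h2.const_add u
  rwa [mul_comm (Real.exp _) K] at h3

/-- Adding a multiple of a timelike vector `V` keeps a vector causal under a change of metric. -/
theorem nonpos_add_smul {G G' : E →L[ℝ] E →L[ℝ] ℝ} {v V : E} {l B κ m : ℝ}
    (hv : G' v v ≤ 0) (hl : ‖G - G'‖ ≤ l) (hB : ‖v‖ ≤ B) (hVv : G V v ≤ -κ) (hVV : G V V ≤ 0)
    (hsym : G v V = G V v) (hκ : 0 ≤ κ) (hm : 0 ≤ m) (hlm : l * B ^ 2 ≤ m * κ) :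
    G (v + m • V) (v + m • V) ≤ 0 := by
  have h2 : (G - G') v v ≤ l * B ^ 2 := by
    refine (Real.le_norm_self _).trans ((ContinuousLinearMap.le_opNorm₂ _ _ _).trans ?_)
    have hl0 : 0 ≤ l := (norm_nonneg _).trans hl
    have hB0 : 0 ≤ B := (norm_nonneg _).trans hB
    calc ‖G - G'‖ * ‖v‖ * ‖v‖ ≤ l * B * B := by gcongr
      _ = l * B ^ 2 := by ring
  simp only [_root_.sub_apply] at h2
  simp only [map_add, map_smul, _root_.add_apply, _root_.smul_apply, smul_eq_mul, hsym]
  -- The cross term counts twice and contributes at most `-2 * m * κ`, while `G v v` exceeds `G' v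
  -- v` by at most `l * B ^ 2 ≤ m * κ`.
  have h5 : m * G V v ≤ m * -κ := mul_le_mul_of_nonneg_left hVv hm
  have h6 : m * (m * G V V) ≤ 0 :=
    mul_nonpos_of_nonneg_of_nonpos hm (mul_nonpos_of_nonneg_of_nonpos hm hVV)
  have h7 : 0 ≤ m * κ := mul_nonneg hm hκ
  linarith

/-- The starting point of a short causal curve `c` can be moved freely in a neighbourhood, with
little change of its end point: translate the curve and add an exponentially growing push in a
timelike direction. -/
theorem exists_deformation {G : E → E →L[ℝ] E →L[ℝ] ℝ} {T : E → E} {W : Set E} {c : ℝ → E}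
    {a b : ℝ} (hab : a < b) (hW : W ∈ 𝓝 (c a)) (hG : ContDiffAt ℝ 1 G (c a))
    (hT : ContinuousAt T (c a)) (hsym : ∀ p ∈ W, ∀ v w, G p v w = G p w v)
    (hTT : G (c a) (T (c a)) (T (c a)) < 0) (hc : ContDiffOn ℝ ∞ c (Icc a b))
    (hfut : ∀ s ∈ Icc a b, G (c s) (derivWithin c (Icc a b) s) (derivWithin c (Icc a b) s) ≤ 0 ∧
      G (c s) (T (c s)) (derivWithin c (Icc a b) s) < 0) :
    ∃ b', a < b' ∧ b' ≤ b ∧ ∀ s₁ ∈ Ioc a b', ∀ ρ > 0, ∃ ε > 0, ∀ w, dist w (c a) < ε →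
      ∃ η : ℝ → E, ContDiffOn ℝ ∞ η (Icc a s₁) ∧ η a = w ∧ dist (η s₁) (c s₁) < ρ ∧
        ∀ s ∈ Icc a s₁, η s ∈ W ∧
          G (η s) (derivWithin η (Icc a s₁) s) (derivWithin η (Icc a s₁) s) ≤ 0 ∧
          G (η s) (T (η s)) (derivWithin η (Icc a s₁) s) < 0 := by
  set c' : ℝ → E := derivWithin c (Icc a b) with hc'
  have hc'c : ContinuousOn c' (Icc a b) :=
    hc.continuousOn_derivWithin (uniqueDiffOn_Icc hab) (by simp)
  have ha : a ∈ Icc a b := left_mem_Icc.2 hab.le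
  set p₀ := c a with hp₀
  set v₀ := c' a with hv₀
  set V := T p₀ with hV
  -- Half the value at the base point, so that `G p V v < -κ` persists nearby.
  set κ := -(G p₀ V v₀) / 2 with hκ
  have hVv : G p₀ V v₀ < 0 := (hfut a ha).2
  have hκ0 : 0 < κ := by rw [hκ]; linarith
  obtain ⟨L, U, hU, hL⟩ := hG.exists_lipschitzOnWith
  have hfst : ContinuousAt (fun q : E × E ↦ q.1) (p₀, v₀) := continuousAt_fst
  have hsnd : ContinuousAt (fun q : E × E ↦ q.2) (p₀, v₀) := continuousAt_snd
  have hGc : ContinuousAt (fun q : E × E ↦ G q.1) (p₀, v₀) :=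
    ContinuousAt.comp (g := G) hG.continuousAt hfst
  have hTc : ContinuousAt (fun q : E × E ↦ T q.1) (p₀, v₀) :=
    ContinuousAt.comp (g := T) hT hfst
  have e1 : ∀ᶠ q in 𝓝 (p₀, v₀), G q.1 V q.2 < -κ :=
    ((hGc.clm_apply continuousAt_const).clm_apply hsnd).eventually_lt continuousAt_const (by
        simp only [hκ]; linarith)
  have e2 : ∀ᶠ q in 𝓝 (p₀, v₀), G q.1 (T q.1) q.2 < 0 :=
    ((hGc.clm_apply hTc).clm_apply hsnd).eventually_lt continuousAt_const hVv
  have e3 : ∀ᶠ q in 𝓝 (p₀, v₀), G q.1 V V < 0 :=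
    ((hGc.clm_apply continuousAt_const).clm_apply continuousAt_const).eventually_lt
      continuousAt_const hTT
  have e4 : ∀ᶠ q in 𝓝 (p₀, v₀), q.1 ∈ W ∩ U := hfst.eventually_mem (inter_mem hW hU)
  have e5 : ∀ᶠ q in 𝓝 (p₀, v₀), ‖q.2‖ < ‖v₀‖ + 1 :=
    hsnd.norm.eventually_lt continuousAt_const (by simp)
  obtain ⟨δ, hδ, H⟩ := Metric.eventually_nhds_iff.1 (e1.and (e2.and (e3.and (e4.and e5))))
  have H : ∀ p v, dist p p₀ < δ → dist v v₀ < δ → _ := fun p v hp hv ↦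
    H (y := (p, v)) (by simp only [Prod.dist_eq, max_lt_iff]; exact ⟨hp, hv⟩)
  have hnear : ∀ᶠ s in 𝓝[Icc a b] a, dist (c s) p₀ < δ / 2 ∧ dist (c' s) v₀ < δ / 2 := by
    have h1 := (hc.continuousOn a ha).eventually_mem (Metric.ball_mem_nhds (c a) (half_pos hδ))
    have h2 := (hc'c a ha).eventually_mem (Metric.ball_mem_nhds (c' a) (half_pos hδ))
    exact h1.and h2
  rw [nhdsWithin_Icc_eq_nhdsGE hab] at hnear
  obtain ⟨u, hu, hsub⟩ := mem_nhdsGE_iff_exists_Icc_subset.1 hnear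
  refine ⟨min u b, lt_min hu hab, min_le_right _ _, fun s₁ hs₁ ρ hρ ↦ ?_⟩
  have hs₁b : s₁ ≤ b := hs₁.2.trans (min_le_right _ _)
  have hnear : ∀ s ∈ Icc a s₁, dist (c s) p₀ < δ / 2 ∧ dist (c' s) v₀ < δ / 2 :=
    fun s hs ↦ hsub ⟨hs.1, hs.2.trans (hs₁.2.trans (min_le_left _ _))⟩
  have hsubI : Icc a s₁ ⊆ Icc a b := Icc_subset_Icc_right hs₁b
  set B := ‖v₀‖ + 1 with hB
  set A := 1 + ‖V‖ with hA
  have hA1 : 1 ≤ A := by rw [hA]; linarith [norm_nonneg V]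
  -- With `Q = exp (K * (s - a))` the curve is displaced by at most `ε * Q * A`, so the metric
  -- changes by at most `L * (ε * Q * A)`. The push has speed `ε * K * Q` along `V`, and this `K`
  -- makes its gain `ε * K * Q * κ` equal to the possible loss `L * (ε * Q * A) * B ^ 2`. The
  -- exponential is needed since the push adds to the displacement it must compensate.
  set K := (L : ℝ) * A * B ^ 2 / κ with hK
  have hK0 : 0 ≤ K := by positivity
  set F := Real.exp (K * (s₁ - a)) with hF
  have hF0 : 0 < F := Real.exp_pos _
  -- Small enough to keep both the displacement and the added velocity below `min (δ / 2) ρ` on the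
  -- whole interval.
  set ε := min (δ / 2) ρ / (2 * A * F * (1 + K)) with hε
  have hmin : 0 < min (δ / 2) ρ := lt_min (half_pos hδ) hρ
  have hden : 0 < 2 * A * F * (1 + K) := by positivity
  have hε0 : 0 < ε := div_pos hmin hden
  have hεm : ε * (2 * A * F * (1 + K)) = min (δ / 2) ρ := div_mul_cancel₀ _ hden.ne'
  have hsmall1 : ε * F * A < min (δ / 2) ρ := by
    have : 0 < ε * F * A := by positivity
    have : 0 ≤ ε * F * A * K := by positivity
    nlinarith
  have hsmall2 : ε * (K * F) * ‖V‖ < min (δ / 2) ρ := by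
    have h1 : 0 < ε * F * A := by positivity
    have h2 : ε * (K * F) * ‖V‖ ≤ ε * F * A * K := by
      have : ‖V‖ ≤ A := by rw [hA]; linarith
      calc ε * (K * F) * ‖V‖ ≤ ε * (K * F) * A := by gcongr
        _ = ε * F * A * K := by ring
    have : 0 ≤ ε * F * A * K := by positivity
    nlinarith
  refine ⟨ε, hε0, fun w hw ↦ ?_⟩
  -- The push vanishes at `s = a`, so `η` starts exactly at `w`.
  set η : ℝ → E := fun s ↦ c s + ((w - p₀) + (ε * (Real.exp (K * (s - a)) - 1)) • V) with hη
  have hexp : ∀ s ∈ Icc a s₁, 1 ≤ Real.exp (K * (s - a)) ∧ Real.exp (K * (s - a)) ≤ F := by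
    intro s hs
    refine ⟨Real.one_le_exp (mul_nonneg hK0 (by linarith [hs.1])), Real.exp_le_exp.2 ?_⟩
    exact mul_le_mul_of_nonneg_left (by linarith [hs.2]) hK0
  have hdist : ∀ s ∈ Icc a s₁, ‖η s - c s‖ ≤ ε * Real.exp (K * (s - a)) * A := by
    intro s hs
    obtain ⟨h1, h2⟩ := hexp s hs
    have h3 : ‖w - p₀‖ ≤ ε := by rw [← dist_eq_norm]; exact hw.le
    have h4 : 0 ≤ ε * (Real.exp (K * (s - a)) - 1) := mul_nonneg hε0.le (by linarith)
    calc ‖η s - c s‖ = ‖(w - p₀) + (ε * (Real.exp (K * (s - a)) - 1)) • V‖ := by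
          rw [hη]; simp only [add_sub_cancel_left]
      _ ≤ ε + (ε * (Real.exp (K * (s - a)) - 1)) * ‖V‖ := by
          refine (norm_add_le _ _).trans (add_le_add h3 ?_)
          rw [norm_smul, Real.norm_of_nonneg h4]
      _ ≤ ε * Real.exp (K * (s - a)) * A := by
          rw [hA]
          have := norm_nonneg V
          nlinarith [mul_nonneg hε0.le this, mul_le_mul_of_nonneg_left h1 hε0.le]
  have hdist' : ∀ s ∈ Icc a s₁, ‖η s - c s‖ < min (δ / 2) ρ := by
    intro s hs
    refine (hdist s hs).trans_lt (lt_of_le_of_lt ?_ hsmall1)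
    have := (hexp s hs).2
    gcongr
  have hηnear : ∀ s ∈ Icc a s₁, dist (η s) p₀ < δ := by
    intro s hs
    have h1 := (hdist' s hs).trans_le (min_le_left _ _)
    rw [← dist_eq_norm] at h1
    linarith [dist_triangle (η s) (c s) p₀, (hnear s hs).1]
  have hηd : ∀ s ∈ Icc a s₁, HasDerivWithinAt η
      (c' s + (ε * (K * Real.exp (K * (s - a)))) • V) (Icc a s₁) s := by
    intro s hs
    have h1 : HasDerivWithinAt c (c' s) (Icc a b) s :=
      ((hc.differentiableOn (by simp)) s (hsubI hs)).hasDerivWithinAt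
    exact (h1.mono hsubI).add (hasDerivAt_push (w - p₀) V ε K a s).hasDerivWithinAt
  refine ⟨η, ?_, ?_, ?_, fun s hs ↦ ⟨?_, ?_⟩⟩
  · refine (hc.mono hsubI).add ?_
    fun_prop
  · simp only [hη, ← hp₀, sub_self, mul_zero, Real.exp_zero, zero_smul, add_zero, add_sub_cancel]
  · rw [dist_eq_norm]
    exact (hdist' s₁ ⟨hs₁.1.le, le_rfl⟩).trans_le (min_le_right _ _)
  · exact (H _ v₀ (hηnear s hs) (by rwa [dist_self])).2.2.2.1.1
  rw [(hηd s hs).derivWithin (uniqueDiffOn_Icc hs₁.1 s hs)]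
  set Q := Real.exp (K * (s - a)) with hQ
  obtain ⟨hQ1, hQF⟩ := hexp s hs
  have hc'near : dist (c' s) v₀ < δ := by linarith [(hnear s hs).2]
  have hcnear : dist (c s) p₀ < δ := by linarith [(hnear s hs).1]
  have Hs := H _ _ (hηnear s hs) hc'near
  have Hc := H _ _ hcnear hc'near
  have hm0 : 0 ≤ ε * (K * Q) := by positivity
  constructor
  · refine nonpos_add_smul (l := L * (ε * Q * A)) (hfut s (hsubI hs)).1 ?_ Hs.2.2.2.2.le Hs.1.le
      Hs.2.2.1.le (hsym _ Hs.2.2.2.1.1 _ _) hκ0.le hm0 (le_of_eq ?_)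
    · exact (hL.norm_sub_le Hs.2.2.2.1.2 Hc.2.2.2.1.2).trans
        (mul_le_mul_of_nonneg_left (hdist s hs) L.2)
    · have hKκ : K * κ = L * A * B ^ 2 := div_mul_cancel₀ _ hκ0.ne'
      calc L * (ε * Q * A) * B ^ 2 = ε * Q * (L * A * B ^ 2) := by ring
        _ = ε * (K * Q) * κ := by rw [← hKκ]; ring
  · refine (H _ _ (hηnear s hs) ?_).2.1
    have h1 : ‖(ε * (K * Q)) • V‖ < δ / 2 := by
      rw [norm_smul, Real.norm_of_nonneg hm0]
      refine lt_of_le_of_lt ?_ (hsmall2.trans_le (min_le_left _ _))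
      gcongr
    calc dist (c' s + (ε * (K * Q)) • V) v₀
        ≤ dist (c' s + (ε * (K * Q)) • V) (c' s) + dist (c' s) v₀ := dist_triangle _ _ _
      _ < δ / 2 + δ / 2 := by
        refine add_lt_add ?_ (hnear s hs).2
        rwa [dist_eq_norm, add_sub_cancel_left]
      _ = δ := by ring

end Deformation

/-- Locally, points of a causal curve that are followed by points of a chronological past belong to
that past. -/
theorem IsSmoothCausalOn.exists_mem_past_of_mem_past {γ : ℝ → M} {a b : ℝ} (hab : a < b)
    (hγ : S.IsSmoothCausalOn γ a b) :
    ∃ b', a < b' ∧ b' ≤ b ∧ ∀ s ∈ Ioc a b', ∀ y, γ s ∈ S.past y → γ a ∈ S.past y := by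
  obtain ⟨b₁, hab₁, hb₁, hsrc⟩ := exists_subinterval_source hab hγ.1.continuousOn
    (chart_source_mem_nhds 𝔼 (γ a))
  have hγ₁ := hγ.mono le_rfl hb₁ hab₁
  have hTT : S.chartMetric (γ a) (extChartAt (𝓡 d) (γ a) (γ a))
      (S.chartTime (γ a) (extChartAt (𝓡 d) (γ a) (γ a)))
      (S.chartTime (γ a) (extChartAt (𝓡 d) (γ a) (γ a))) < 0 := by
    rw [chartTime_apply (mem_chart_source _ _), chartMetric_toChart (mem_chart_source _ _)]
    exact S.timelike_T _
  obtain ⟨b', hab', hb', H⟩ := exists_deformation hab₁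
    (c := fun s ↦ extChartAt (𝓡 d) (γ a) (γ s)) (extChartAt_target_mem_nhds (I := 𝓡 d) (γ a))
    ((contDiffAt_chartMetric S (γ a)).of_le (show (1 : WithTop ℕ∞) ≤ ∞ by simp))
    (continuousAt_chartTime S (γ a)) (fun p hp ↦ chartMetric_symm hp) hTT
    (contDiffOn_chart_comp hγ₁.1 hsrc) (fun s hs ↦ hγ₁.chartFuture hab₁ hs (hsrc s hs))
  refine ⟨b', hab', hb'.trans hb₁, fun s hs y hy ↦ ?_⟩
  have hyt : ∀ᶠ q in 𝓝 (extChartAt (𝓡 d) (γ a) (γ s)),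
      (extChartAt (𝓡 d) (γ a)).symm q ∈ S.past y := by
    have hin : γ s ∈ (extChartAt (𝓡 d) (γ a)).source := by
      rw [extChartAt_source_eq]; exact hsrc s ⟨hs.1.le, hs.2.trans hb'⟩
    refine (continuousAt_extChartAt_symm' hin).eventually_mem ?_
    rw [(extChartAt (𝓡 d) (γ a)).left_inv hin]
    exact isOpen_interior.mem_nhds hy
  obtain ⟨ρ, hρ, hyt⟩ := Metric.eventually_nhds_iff.1 hyt
  obtain ⟨ε, hε, H⟩ := H s hs ρ hρ
  rw [past, mem_interior_iff_mem_nhds]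
  have hball : ∀ᶠ w in 𝓝 (γ a),
      dist (extChartAt (𝓡 d) (γ a) w) (extChartAt (𝓡 d) (γ a) (γ a)) < ε :=
    (continuousAt_extChartAt (I := 𝓡 d) (γ a)).eventually_mem (Metric.ball_mem_nhds _ hε)
  -- Every `w` near `γ a` starts a deformed curve ending so close to `γ s` that it is still in the
  -- open set `past y`; hence `w` precedes `y`.
  filter_upwards [hball, extChartAt_source_mem_nhds (I := 𝓡 d) (γ a)] with w hw hwsrc
  obtain ⟨η, hη, hηa, hηs, hηf⟩ := H _ hw
  have hcurve := isSmoothCausalOn_of_chart (S := S) hs.1 hη (fun t ht ↦ (hηf t ht).1)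
    (fun t ht ↦ (hηf t ht).2)
  have := hcurve.after le_rfl hs.1 le_rfl
  rw [hηa, (extChartAt (𝓡 d) (γ a)).left_inv hwsrc] at this
  exact this.trans (after_of_mem_past (hyt hηs))

/-- The parameters outside the open past form a compact set. At its greatest element, the local
version applied to the rest of the curve gives a contradiction. -/
theorem IsSmoothCausalOn.mem_past_of_mem_past {γ : ℝ → M} {a b : ℝ} (hab : a < b)
    (hγ : S.IsSmoothCausalOn γ a b) {y : M} (hy : γ b ∈ S.past y) : γ a ∈ S.past y := by
  by_contra hna
  have hcl : IsClosed {s | s ∈ Icc a b ∧ γ s ∉ S.past y} := by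
    have := hγ.1.continuousOn.preimage_isClosed_of_isClosed isClosed_Icc
      (isOpen_interior (s := {w | S.After w y})).isClosed_compl
    exact this
  have hcpt : IsCompact {s | s ∈ Icc a b ∧ γ s ∉ S.past y} :=
    isCompact_Icc.of_isClosed_subset hcl fun s hs ↦ hs.1
  obtain ⟨s₀, ⟨hs₀, hs₀n⟩, hmax⟩ := hcpt.exists_isGreatest ⟨a, left_mem_Icc.2 hab.le, hna⟩
  have hs₀b : s₀ < b := lt_of_le_of_ne hs₀.2 (by rintro rfl; exact hs₀n hy)
  obtain ⟨b', h1, h2, h3⟩ := (hγ.mono hs₀.1 le_rfl hs₀b).exists_mem_past_of_mem_past hs₀b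
  refine hs₀n (h3 b' ⟨h1, le_rfl⟩ y ?_)
  by_contra hb'
  exact absurd (hmax ⟨⟨hs₀.1.trans h1.le, h2⟩, hb'⟩) (not_le.2 h1)

/-- The push-up property. -/
theorem After.mem_past {x y z : M} (h : S.After x y) (hy : y ∈ S.past z) : x ∈ S.past z := by
  rw [after_iff_transGen] at h
  induction h using Relation.TransGen.head_induction_on with
  | single h =>
    obtain ⟨γ, a, b, hab, hγ, rfl, rfl⟩ := h
    exact hγ.mem_past_of_mem_past hab hy
  | head h _ ih =>
    obtain ⟨γ, a, b, hab, hγ, rfl, rfl⟩ := h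
    exact hγ.mem_past_of_mem_past hab ih

end Spacetime

/-! ### Local uniqueness of null curves -/

namespace Spacetime

open Filter Topology

section NullUniqueness

/-- Inverse of a function with positive derivative on an interval. -/
theorem exists_inverse_on_Icc {f f' : ℝ → ℝ} {a b : ℝ} (hab : a < b)
    (hf : ∀ s ∈ Icc a b, HasDerivWithinAt f (f' s) (Icc a b) s) (hpos : ∀ s ∈ Icc a b, 0 < f' s) :
    f a < f b ∧ ∃ σ : ℝ → ℝ, σ (f a) = a ∧ ∀ t ∈ Icc (f a) (f b), σ t ∈ Icc a b ∧ f (σ t) = t ∧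
      HasDerivWithinAt σ (f' (σ t))⁻¹ (Icc (f a) (f b)) t := by
  have hcont : ContinuousOn f (Icc a b) := fun s hs ↦ (hf s hs).continuousWithinAt
  have hmono : StrictMonoOn f (Icc a b) := by
    refine strictMonoOn_of_deriv_pos (convex_Icc a b) hcont fun s hs ↦ ?_
    rw [interior_Icc] at hs
    have h1 := (hf s (Ioo_subset_Icc_self hs)).hasDerivAt (Icc_mem_nhds hs.1 hs.2)
    rw [h1.deriv]
    exact hpos s (Ioo_subset_Icc_self hs)
  have ha := left_mem_Icc.2 hab.le
  have hb := right_mem_Icc.2 hab.le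
  have hfab : f a < f b := hmono ha hb hab
  refine ⟨hfab, ?_⟩
  let F : Icc a b → Icc (f a) (f b) := fun s ↦
    ⟨f s, hmono.monotoneOn ha s.2 s.2.1, hmono.monotoneOn s.2 hb s.2.2⟩
  have hF : StrictMono F := fun s t hst ↦ hmono s.2 t.2 hst
  have hFs : Function.Surjective F := by
    rintro ⟨t, ht⟩
    obtain ⟨s, hs, hst⟩ := intermediate_value_Icc hab.le hcont ht
    exact ⟨⟨s, hs⟩, Subtype.ext hst⟩
  -- An order isomorphism of intervals is a homeomorphism, so continuity of the inverse, needed for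
  -- the derivative rule, comes for free; `projIcc` extends it to the line.
  let e := hF.orderIsoOfSurjective F hFs
  have hσ : Continuous fun t : ℝ ↦ (e.symm (projIcc (f a) (f b) hfab.le t) : ℝ) :=
    continuous_subtype_val.comp (e.symm.continuous.comp continuous_projIcc)
  have hinv : ∀ t ∈ Icc (f a) (f b), f (e.symm (projIcc (f a) (f b) hfab.le t) : ℝ) = t := by
    intro t ht
    have h1 : e (e.symm (projIcc (f a) (f b) hfab.le t)) = projIcc (f a) (f b) hfab.le t :=
      e.apply_symm_apply _
    have h2 := congrArg Subtype.val h1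
    rw [projIcc_of_mem hfab.le ht] at h2 ⊢
    exact h2
  have hmem : ∀ t, (e.symm (projIcc (f a) (f b) hfab.le t) : ℝ) ∈ Icc a b := fun t ↦ Subtype.prop _
  refine ⟨fun t : ℝ ↦ (e.symm (projIcc (f a) (f b) hfab.le t) : ℝ),
    hmono.injOn (hmem _) ha (hinv _ (left_mem_Icc.2 hfab.le)), fun t ht ↦ ?_⟩
  refine ⟨hmem t, hinv t ht, ?_⟩
  have hne := (hpos _ (hmem t)).ne'
  have h1 := hf _ (hmem t)
  have h2 := HasFDerivWithinAt.of_local_left_inverse (𝕜 := ℝ)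
    (f' := ContinuousLinearEquiv.unitsEquivAut ℝ (Units.mk0 _ hne)) (s := Icc (f a) (f b))
    (g := fun t : ℝ ↦ (e.symm (projIcc (f a) (f b) hfab.le t) : ℝ)) (a := t)
    (tendsto_nhdsWithin_iff.2 ⟨hσ.continuousAt.tendsto.mono_left nhdsWithin_le_nhds,
      Eventually.of_forall hmem⟩) ?_ ht
    (eventually_nhdsWithin_of_forall hinv)
  · have h3 := h2.hasDerivWithinAt
    simpa using h3
  · have h3 := h1.hasFDerivWithinAt
    refine h3.congr_fderiv ?_
    ext; simp

variable {E : Type*} [NormedAddCommGroup E] [NormedSpace ℝ E]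

theorem exists_parametrization_of_pos {c : ℝ → E} {a b : ℝ} (hab : a < b)
    (hc : ContDiffOn ℝ ∞ c (Icc a b)) (τ : E →L[ℝ] ℝ)
    (hpos : ∀ s ∈ Icc a b, 0 < τ (derivWithin c (Icc a b) s)) :
    τ (c a) < τ (c b) ∧ ∃ σ : ℝ → ℝ, σ (τ (c a)) = a ∧ ∀ t ∈ Icc (τ (c a)) (τ (c b)),
      σ t ∈ Icc a b ∧ τ (c (σ t)) = t ∧
      HasDerivWithinAt (fun t ↦ c (σ t)) ((τ (derivWithin c (Icc a b) (σ t)))⁻¹ •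
        derivWithin c (Icc a b) (σ t)) (Icc (τ (c a)) (τ (c b))) t := by
  have hd : ∀ s ∈ Icc a b, HasDerivWithinAt c (derivWithin c (Icc a b) s) (Icc a b) s :=
    fun s hs ↦ (hc.differentiableOn (by simp) s hs).hasDerivWithinAt
  obtain ⟨h1, σ, hσ, H⟩ := exists_inverse_on_Icc (f := fun s ↦ τ (c s)) hab
    (fun s hs ↦ (τ.hasFDerivAt (x := c s)).comp_hasDerivWithinAt s (hd s hs)) hpos
  refine ⟨h1, σ, hσ, fun t ht ↦ ⟨(H t ht).1, (H t ht).2.1, ?_⟩⟩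
  exact (hd _ (H t ht).1).scomp t (H t ht).2.2 fun t ht ↦ (H t ht).1

/-- Near its starting point, a curve can be parametrized by a linear functional that grows along
it. -/
theorem exists_parametrization {c : ℝ → E} {a b : ℝ} (hab : a < b)
    (hc : ContDiffOn ℝ ∞ c (Icc a b)) (τ : E →L[ℝ] ℝ) {c' N : ℝ → E}
    (hc' : c' = derivWithin c (Icc a b)) (hN : N = fun s ↦ (τ (c' s))⁻¹ • c' s)
    (hpos : 0 < τ (c' a)) {δ : ℝ} (hδ : 0 < δ) :
    ∃ T > τ (c a), ∃ σ : ℝ → ℝ, σ (τ (c a)) = a ∧ ∀ t ∈ Icc (τ (c a)) T,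
      σ t ∈ Ico a b ∧ τ (c (σ t)) = t ∧ 0 < τ (c' (σ t)) ∧ dist (c (σ t)) (c a) < δ ∧
      dist (N (σ t)) (N a) < δ ∧
      HasDerivWithinAt (fun t ↦ c (σ t)) (N (σ t)) (Icc (τ (c a)) T) t := by
  have ha : a ∈ Icc a b := left_mem_Icc.2 hab.le
  have hc'c : ContinuousOn c' (Icc a b) := by
    rw [hc']
    exact hc.continuousOn_derivWithin (uniqueDiffOn_Icc hab) (by simp)
  have hτc : ContinuousWithinAt (fun s ↦ τ (c' s)) (Icc a b) a :=
    τ.continuous.continuousAt.comp_continuousWithinAt (hc'c a ha)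
  have hNc : ContinuousWithinAt N (Icc a b) a := by
    rw [hN]
    exact (hτc.inv₀ hpos.ne').smul (hc'c a ha)
  have hnear : ∀ᶠ s in 𝓝[Icc a b] a, 0 < τ (c' s) ∧ dist (c s) (c a) < δ ∧ dist (N s) (N a) < δ :=
    (hτc.eventually_mem (Ioi_mem_nhds hpos)).and
      (((hc.continuousOn a ha).eventually_mem (Metric.ball_mem_nhds _ hδ)).and
        (hNc.eventually_mem (Metric.ball_mem_nhds _ hδ)))
  rw [nhdsWithin_Icc_eq_nhdsGE hab] at hnear
  obtain ⟨u, hu, hsub⟩ := mem_nhdsGE_iff_exists_Icc_subset.1 hnear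
  -- Strictly below `b`, so that the parameters `σ t` stay in `Ico a b`.
  obtain ⟨b', hab', hb'⟩ := _root_.exists_between (lt_min hu hab)
  have hb'b : b' < b := hb'.trans_le (min_le_right _ _)
  have hI : Icc a b' ⊆ Icc a b := Icc_subset_Icc_right hb'b.le
  have hprop : ∀ s ∈ Icc a b', 0 < τ (c' s) ∧ dist (c s) (c a) < δ ∧ dist (N s) (N a) < δ :=
    fun s hs ↦ hsub ⟨hs.1, hs.2.trans (hb'.le.trans (min_le_left _ _))⟩
  have hder : ∀ s ∈ Icc a b', derivWithin c (Icc a b') s = c' s := by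
    intro s hs
    rw [hc', derivWithin_subset hI (uniqueDiffOn_Icc hab' s hs)
      (hc.differentiableOn (by simp) s (hI hs))]
  obtain ⟨h1, σ, hσ, H⟩ := exists_parametrization_of_pos hab' (hc.mono hI) τ
    (fun s hs ↦ by rw [hder s hs]; exact (hprop s hs).1)
  refine ⟨τ (c b'), h1, σ, hσ, fun t ht ↦ ?_⟩
  obtain ⟨h2, h3, h4⟩ := H t ht
  rw [hder _ h2] at h4
  obtain ⟨h5, h6, h7⟩ := hprop _ h2
  refine ⟨⟨h2.1, h2.2.trans_lt hb'b⟩, h3, h5, h6, h7, ?_⟩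
  rw [hN]
  exact h4

attribute [local instance] normedAddCommGroupBilin seminormedAddCommGroupBilin
  seminormedAddGroupBilin

/-- Null vectors `v`, `w` for two metrics `G`, `G'`, both near the null vector `v₀` and with
difference in a transversal subspace, differ at most by a multiple of the difference of the
metrics. -/
theorem norm_sub_le_of_null {G G' : E →L[ℝ] E →L[ℝ] ℝ} {A : E →L[ℝ] ℝ} {v w : E} {l B κ : ℝ}
    (hv : G v v = 0) (hw : G' w w = 0) (hsym : G' v w = G' w v) (hl : ‖G - G'‖ ≤ l)
    (hB : ‖v‖ ≤ B) (hA : 2 * κ * ‖v - w‖ ≤ |A (v - w)|) (hκ : 0 < κ)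
    (hA' : ‖G' (v + w) - A‖ ≤ κ) : ‖v - w‖ ≤ l * B ^ 2 / κ := by
  -- Polarization: the left side is `G' v v - G' w w`, and both `G' w w` and `G v v` vanish.
  have h1 : G' (v + w) (v - w) = -((G - G') v v) := by
    simp only [map_add, map_sub, _root_.add_apply, _root_.sub_apply, hv, hw, hsym]
    ring
  have h2 : |(G - G') v v| ≤ l * B ^ 2 := by
    rw [← Real.norm_eq_abs]
    refine (ContinuousLinearMap.le_opNorm₂ _ _ _).trans ?_
    have hl0 : 0 ≤ l := (norm_nonneg _).trans hl
    have hB0 : 0 ≤ B := (norm_nonneg _).trans hB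
    calc ‖G - G'‖ * ‖v‖ * ‖v‖ ≤ l * B * B := by gcongr
      _ = l * B ^ 2 := by ring
  have h3 : |(G' (v + w) - A) (v - w)| ≤ κ * ‖v - w‖ := by
    rw [← Real.norm_eq_abs]
    exact (ContinuousLinearMap.le_opNorm _ _).trans (by gcongr)
  have h4 : |A (v - w)| ≤ |G' (v + w) (v - w)| + |(G' (v + w) - A) (v - w)| := by
    have : A (v - w) = G' (v + w) (v - w) - (G' (v + w) - A) (v - w) := by
      simp only [_root_.sub_apply]; ring
    rw [this]
    exact abs_sub _ _
  rw [h1, abs_neg] at h4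
  rw [le_div_iff₀ hκ]
  linarith

/-- Null curves with the same initial point and direction agree for a while. -/
theorem exists_common_point {G : E → E →L[ℝ] E →L[ℝ] ℝ} {W : Set E} {c₁ c₂ : ℝ → E} {p₀ : E}
    {a₁ b₁ a₂ b₂ : ℝ} (hab₁ : a₁ < b₁) (hab₂ : a₂ < b₂) (hp₁ : c₁ a₁ = p₀) (hp₂ : c₂ a₂ = p₀)
    (hW : W ∈ 𝓝 p₀) (hG : ContDiffAt ℝ 1 G p₀) (hsym : ∀ p ∈ W, ∀ v w, G p v w = G p w v)
    (hc₁ : ContDiffOn ℝ ∞ c₁ (Icc a₁ b₁)) (hc₂ : ContDiffOn ℝ ∞ c₂ (Icc a₂ b₂))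
    (hn₁ : ∀ s ∈ Icc a₁ b₁,
      G (c₁ s) (derivWithin c₁ (Icc a₁ b₁) s) (derivWithin c₁ (Icc a₁ b₁) s) = 0)
    (hn₂ : ∀ s ∈ Icc a₂ b₂,
      G (c₂ s) (derivWithin c₂ (Icc a₂ b₂) s) (derivWithin c₂ (Icc a₂ b₂) s) = 0)
    {r : ℝ} (hr : 0 < r)
    (hpar : derivWithin c₂ (Icc a₂ b₂) a₂ = r • derivWithin c₁ (Icc a₁ b₁) a₁)
    (τ : E →L[ℝ] ℝ) (hτ : 0 < τ (derivWithin c₁ (Icc a₁ b₁) a₁)) {κ : ℝ} (hκ : 0 < κ)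
    (hκτ : ∀ u, τ u = 0 → κ * ‖u‖ ≤ |G p₀ (derivWithin c₁ (Icc a₁ b₁) a₁) u|) :
    ∃ s ∈ Ioo a₁ b₁, ∃ t ∈ Ioo a₂ b₂, c₁ s = c₂ t ∧ ∃ r' : ℝ, 0 < r' ∧
      derivWithin c₂ (Icc a₂ b₂) t = r' • derivWithin c₁ (Icc a₁ b₁) s := by
  set c₁' := derivWithin c₁ (Icc a₁ b₁) with hc₁'
  set c₂' := derivWithin c₂ (Icc a₂ b₂) with hc₂'
  -- Velocities normalized by `τ`, that is, for the common parameter `τ`. Their difference lies in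
  -- the kernel of `τ`, where transversality gives control.
  set N₁ : ℝ → E := fun s ↦ (τ (c₁' s))⁻¹ • c₁' s with hN₁
  set N₂ : ℝ → E := fun s ↦ (τ (c₂' s))⁻¹ • c₂' s with hN₂
  set v₀ := N₁ a₁ with hv₀
  have hτ₂ : 0 < τ (c₂' a₂) := by
    rw [hpar, map_smul, smul_eq_mul]; positivity
  have hv₀₂ : N₂ a₂ = v₀ := by
    simp only [hv₀, hN₁, hN₂, hpar, map_smul, smul_eq_mul, smul_smul]
    congr 1
    field_simp
  set κ' := (τ (c₁' a₁))⁻¹ * κ with hκ'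
  have hκ'0 : 0 < κ' := by positivity
  -- The limit of `G p (v + w)` as both null vectors tend to `v₀`. Its lower bound `2 * κ'` on the
  -- kernel leaves `κ'` after an error of size `κ'` is absorbed.
  set A := G p₀ (v₀ + v₀) with hA
  have hAu : ∀ u, τ u = 0 → 2 * κ' * ‖u‖ ≤ |A u| := by
    intro u hu
    have h1 : A u = 2 * (τ (c₁' a₁))⁻¹ * G p₀ (c₁' a₁) u := by
      simp only [hA, hv₀, hN₁, map_add, map_smul, _root_.add_apply, _root_.smul_apply, smul_eq_mul]
      ring
    rw [h1, abs_mul, abs_of_pos (by positivity : 0 < 2 * (τ (c₁' a₁))⁻¹), hκ']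
    have := mul_le_mul_of_nonneg_left (hκτ u hu) (by positivity : 0 ≤ 2 * (τ (c₁' a₁))⁻¹)
    calc _ = 2 * (τ (c₁' a₁))⁻¹ * (κ * ‖u‖) := by ring
      _ ≤ _ := this
  obtain ⟨L, U, hU, hL⟩ := hG.exists_lipschitzOnWith
  have hfst : ContinuousAt (fun q : E × E × E ↦ q.1) (p₀, v₀, v₀) := continuousAt_fst
  have hGc : ContinuousAt (fun q : E × E × E ↦ G q.1) (p₀, v₀, v₀) :=
    ContinuousAt.comp (g := G) hG.continuousAt hfst
  have hvw : ContinuousAt (fun q : E × E × E ↦ q.2.1 + q.2.2) (p₀, v₀, v₀) := by fun_prop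
  have e1 : ∀ᶠ q in 𝓝 (p₀, v₀, v₀), dist (G q.1 (q.2.1 + q.2.2)) A < κ' :=
    (hGc.clm_apply hvw).eventually_mem (Metric.ball_mem_nhds _ hκ'0)
  have e2 : ∀ᶠ q in 𝓝 (p₀, v₀, v₀), q.1 ∈ W ∩ U := hfst.eventually_mem (inter_mem hW hU)
  have e3 : ∀ᶠ q in 𝓝 (p₀, v₀, v₀), ‖q.2.1‖ < ‖v₀‖ + 1 :=
    ContinuousAt.eventually_lt (f := fun q : E × E × E ↦ ‖q.2.1‖) (by fun_prop)
      continuousAt_const (by simp)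
  obtain ⟨δ, hδ, H⟩ := Metric.eventually_nhds_iff.1 (e1.and (e2.and e3))
  have H : ∀ p v w, dist p p₀ < δ → dist v v₀ < δ → dist w v₀ < δ → _ := fun p v w hp hv hw ↦
    H (y := (p, v, w)) (by simp only [Prod.dist_eq, max_lt_iff]; exact ⟨hp, hv, hw⟩)
  obtain ⟨T₁, hT₁, σ₁, hσ₁, H₁⟩ := exists_parametrization hab₁ hc₁ τ hc₁' hN₁ hτ hδ
  obtain ⟨T₂, hT₂, σ₂, hσ₂, H₂⟩ := exists_parametrization hab₂ hc₂ τ hc₂' hN₂ hτ₂ hδ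
  rw [hp₁] at hT₁ H₁ hσ₁
  rw [hp₂] at hT₂ H₂ hσ₂
  set t₀ := τ p₀ with ht₀
  set T := min T₁ T₂ with hT
  have ht₀T : t₀ < T := lt_min hT₁ hT₂
  have hI₁ : Icc t₀ T ⊆ Icc t₀ T₁ := Icc_subset_Icc_right (min_le_left _ _)
  have hI₂ : Icc t₀ T ⊆ Icc t₀ T₂ := Icc_subset_Icc_right (min_le_right _ _)
  set f : ℝ → E := fun t ↦ c₁ (σ₁ t) - c₂ (σ₂ t) with hf
  have hfd : ∀ t ∈ Icc t₀ T, HasDerivWithinAt f (N₁ (σ₁ t) - N₂ (σ₂ t)) (Icc t₀ T) t :=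
    fun t ht ↦ ((H₁ t (hI₁ ht)).2.2.2.2.2.mono hI₁).sub ((H₂ t (hI₂ ht)).2.2.2.2.2.mono hI₂)
  have hmem₀ : t₀ ∈ Icc t₀ T := left_mem_Icc.2 ht₀T.le
  have hf₀ : f t₀ = 0 := by simp only [hf, hσ₁, hσ₂, hp₁, hp₂, sub_self]
  have hnull : ∀ (c' : ℝ → E) (p : E) (s : ℝ), G p (c' s) (c' s) = 0 →
      G p ((τ (c' s))⁻¹ • c' s) ((τ (c' s))⁻¹ • c' s) = 0 := by
    intro c' p s h
    simp only [map_smul, _root_.smul_apply, h, smul_zero]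
  have hbound : ∀ t ∈ Icc t₀ T,
      ‖N₁ (σ₁ t) - N₂ (σ₂ t)‖ ≤ L * (‖v₀‖ + 1) ^ 2 / κ' * ‖f t‖ := by
    intro t ht
    obtain ⟨hs₁, hτ₁, hpos₁, hd₁, hdN₁, -⟩ := H₁ t (hI₁ ht)
    obtain ⟨hs₂, hτ₂, hpos₂, hd₂, hdN₂, -⟩ := H₂ t (hI₂ ht)
    rw [hv₀₂] at hdN₂
    have K₁ := H _ _ _ hd₁ hdN₁ hdN₂
    have K₂ := H _ _ _ hd₂ hdN₁ hdN₂
    have hker : τ (N₁ (σ₁ t) - N₂ (σ₂ t)) = 0 := by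
      simp only [hN₁, hN₂, map_sub, map_smul, smul_eq_mul]
      rw [inv_mul_cancel₀ hpos₁.ne', inv_mul_cancel₀ hpos₂.ne', sub_self]
    have hle := norm_sub_le_of_null (G := G (c₁ (σ₁ t))) (G' := G (c₂ (σ₂ t))) (A := A)
      (l := L * ‖f t‖) (B := ‖v₀‖ + 1)
      (hnull c₁' _ _ (hn₁ _ (Ico_subset_Icc_self hs₁)))
      (hnull c₂' _ _ (hn₂ _ (Ico_subset_Icc_self hs₂)))
      (hsym _ K₂.2.1.1 _ _) (hL.norm_sub_le K₁.2.1.2 K₂.2.1.2) K₁.2.2.le (hAu _ hker) hκ'0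
      (by rw [← dist_eq_norm]; exact K₂.1.le)
    calc _ ≤ _ := hle
      _ = _ := by ring
  have hright : ∀ t ∈ Ico t₀ T, HasDerivWithinAt f (N₁ (σ₁ t) - N₂ (σ₂ t)) (Ici t) t := by
    intro t ht
    have h1 := (hfd t (Ico_subset_Icc_self ht)).mono (Icc_subset_Icc_left ht.1)
    exact h1.mono_of_mem_nhdsWithin (Icc_mem_nhdsGE ht.2)
  -- Grönwall: the derivative of the difference is bounded by a constant times the difference, which
  -- is zero initially.
  have hzero : ∀ t ∈ Icc t₀ T, f t = 0 :=
    eq_zero_of_abs_deriv_le_mul_abs_self_of_eq_zero_right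
      (fun t ht ↦ (hfd t ht).continuousWithinAt) hright hf₀
      fun t ht ↦ hbound t (Ico_subset_Icc_self ht)
  obtain ⟨t, ht⟩ := _root_.exists_between ht₀T
  have htI : t ∈ Icc t₀ T := Ioo_subset_Icc_self ht
  obtain ⟨hs₁, hτ₁, hpos₁, -, -, -⟩ := H₁ t (hI₁ htI)
  obtain ⟨hs₂, hτ₂', hpos₂, -, -, -⟩ := H₂ t (hI₂ htI)
  have hne₁ : a₁ ≠ σ₁ t := by
    intro h; rw [← h, hp₁] at hτ₁; exact ht.1.ne hτ₁
  have hne₂ : a₂ ≠ σ₂ t := by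
    intro h; rw [← h, hp₂] at hτ₂'; exact ht.1.ne hτ₂'
  refine ⟨σ₁ t, ⟨lt_of_le_of_ne hs₁.1 hne₁, hs₁.2⟩, σ₂ t, ⟨lt_of_le_of_ne hs₂.1 hne₂, hs₂.2⟩,
    sub_eq_zero.1 (hzero t htI), τ (c₂' (σ₂ t)) * (τ (c₁' (σ₁ t)))⁻¹, by positivity, ?_⟩
  -- The same bound, at a point where the curves meet, makes the normalized velocities equal.
  have hN : N₁ (σ₁ t) = N₂ (σ₂ t) := by
    have h1 := hbound t htI
    rw [hzero t htI, norm_zero, mul_zero] at h1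
    exact sub_eq_zero.1 (norm_le_zero_iff.1 h1)
  rw [mul_smul]
  change c₂' (σ₂ t) = τ (c₂' (σ₂ t)) • N₁ (σ₁ t)
  rw [hN, hN₂]
  simp only [smul_smul]
  rw [mul_inv_cancel₀ hpos₂.ne', one_smul]

end NullUniqueness

end Spacetime

/-! ### Null directions in dimension two and continuation of null curves -/

namespace Spacetime

open Filter Topology

variable {M : Type*} [TopologicalSpace M]
    [ChartedSpace (EuclideanSpace ℝ (Fin 2)) M] [IsManifold (𝓡 2) ∞ M]
    {S : Spacetime 2 M}

local notation "𝔼²" => EuclideanSpace ℝ (Fin 2)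

/-- Two linear forms on a tangent plane are null coordinates. -/
structure IsNullCoordinates (S : Spacetime 2 M) (x : M)
    (l m : TangentSpace (𝓡 2) x →ₗ[ℝ] ℝ) : Prop where
  g_eq (v w : TangentSpace (𝓡 2) x) : S.g x v w = -(l v * m w + m v * l w)
  eq_zero (v : TangentSpace (𝓡 2) x) : l v = 0 → m v = 0 → v = 0
  pos_left : 0 < l (S.T x)
  pos_right : 0 < m (S.T x)

theorem IsNullCoordinates.swap {x : M} {l m : TangentSpace (𝓡 2) x →ₗ[ℝ] ℝ}
    (h : S.IsNullCoordinates x l m) : S.IsNullCoordinates x m l where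
  g_eq v w := by rw [h.g_eq]; ring
  eq_zero v h₁ h₂ := h.eq_zero v h₂ h₁
  pos_left := h.pos_right
  pos_right := h.pos_left

/-- The form `-c₀² + c₁²` factors as `-(c₀ + c₁) * (c₀ - c₁)`. Since `T` is timelike, the factors
have the same sign on it, and changing both signs preserves the form. -/
theorem exists_isNullCoordinates (S : Spacetime 2 M) (x : M) :
    ∃ l m : TangentSpace (𝓡 2) x →ₗ[ℝ] ℝ, S.IsNullCoordinates x l m := by
  obtain ⟨b, i₀, hb⟩ := S.lorentzian x
  obtain ⟨i₁, hi₁, hsum⟩ : ∃ i₁, i₁ ≠ i₀ ∧ ∀ f : Fin 2 → ℝ, ∑ i, f i = f i₀ + f i₁ := by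
    fin_cases i₀
    · exact ⟨1, by simp, fun f ↦ by simp⟩
    · exact ⟨0, by simp, fun f ↦ by simp [add_comm]⟩
  have hcover : ∀ i, i = i₀ ∨ i = i₁ := by
    intro i; fin_cases i <;> fin_cases i₀ <;> fin_cases i₁ <;> simp_all
  set l : TangentSpace (𝓡 2) x →ₗ[ℝ] ℝ := b.coord i₀ + b.coord i₁ with hl
  set m : TangentSpace (𝓡 2) x →ₗ[ℝ] ℝ := (1 / 2 : ℝ) • (b.coord i₀ - b.coord i₁) with hm
  have hg : ∀ v w, S.g x v w = -(l v * m w + m v * l w) := by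
    intro v w
    have h1 : S.g x v w = ∑ i, ∑ j, b.repr v i * b.repr w j * S.g x (b i) (b j) := by
      conv_lhs => rw [← b.sum_repr v, ← b.sum_repr w]
      simp only [map_sum, map_smul, _root_.sum_apply, _root_.smul_apply, smul_eq_mul,
        Finset.mul_sum]
      rw [Finset.sum_comm]
      exact Finset.sum_congr rfl fun i _ ↦ Finset.sum_congr rfl fun j _ ↦ by ring
    rw [h1, hsum, hsum, hsum]
    simp only [hb, if_true, if_neg hi₁, if_neg hi₁.symm, hl, hm, LinearMap.add_apply,
      LinearMap.smul_apply, LinearMap.sub_apply, Module.Basis.coord_apply, smul_eq_mul]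
    ring
  have hz : ∀ v, l v = 0 → m v = 0 → v = 0 := by
    intro v h1 h2
    simp only [hl, hm, LinearMap.add_apply, LinearMap.smul_apply, LinearMap.sub_apply,
      Module.Basis.coord_apply, smul_eq_mul] at h1 h2
    apply b.repr.map_eq_zero_iff.1
    ext i
    rcases hcover i with rfl | rfl <;> simp <;> linarith
  have hT := S.timelike_T x
  rw [hg] at hT
  have hpos : 0 < l (S.T x) * m (S.T x) := by linarith
  rcases pos_and_pos_or_neg_and_neg_of_mul_pos hpos with ⟨h1, h2⟩ | ⟨h1, h2⟩
  · exact ⟨l, m, hg, hz, h1, h2⟩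
  · refine ⟨-l, -m, fun v w ↦ ?_, fun v h1 h2 ↦ hz v (by simpa using h1) (by simpa using h2), ?_, ?_⟩
    · rw [hg]; simp only [LinearMap.neg_apply]; ring
    · simpa using h1
    · simpa using h2

section LinearAlgebra

variable {x : M} {u v w : TangentSpace (𝓡 2) x}

/-- Future directed causal vectors. -/
def IsFutureCausal {d : ℕ} {M : Type*} [TopologicalSpace M]
    [ChartedSpace (EuclideanSpace ℝ (Fin d)) M] [IsManifold (𝓡 d) ∞ M] (S : Spacetime d M) {x : M}
    (v : TangentSpace (𝓡 d) x) : Prop :=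
  S.IsCausal v ∧ S.IsFutureDirected v

/-- In null coordinates the future cone lies in the closed first quadrant without the origin; signs
of products then decide orthogonality. -/
theorem IsNullCoordinates.of_future {l m : TangentSpace (𝓡 2) x →ₗ[ℝ] ℝ}
    (h : S.IsNullCoordinates x l m) (hv : S.IsFutureCausal v) :
    0 ≤ l v ∧ 0 ≤ m v ∧ 0 < l v + m v := by
  obtain ⟨⟨hv0, hvv⟩, hvT⟩ := hv
  rw [IsFutureDirected, h.g_eq] at hvT
  rw [h.g_eq] at hvv
  have hT1 := h.pos_left
  have hT2 := h.pos_right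
  have h1 : 0 ≤ l v * m v := by linarith
  have hl : 0 ≤ l v := by
    by_contra hneg
    push Not at hneg
    have : m v ≤ 0 := by by_contra h'; push Not at h'; nlinarith
    nlinarith
  have hm : 0 ≤ m v := by
    by_contra hneg
    push Not at hneg
    have : l v ≤ 0 := by by_contra h'; push Not at h'; nlinarith
    nlinarith
  refine ⟨hl, hm, ?_⟩
  by_contra hneg
  exact hv0 (h.eq_zero v (by linarith) (by linarith))

theorem g_nonpos (hv : S.IsFutureCausal v) (hw : S.IsFutureCausal w) : S.g x v w ≤ 0 := by
  obtain ⟨l, m, h⟩ := S.exists_isNullCoordinates x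
  obtain ⟨h1, h2, -⟩ := h.of_future hv
  obtain ⟨h3, h4, -⟩ := h.of_future hw
  rw [h.g_eq]
  have := mul_nonneg h1 h4
  have := mul_nonneg h2 h3
  linarith

/-- Orthogonal future directed causal vectors are null and lie on the same null line. -/
theorem exists_isNullCoordinates_of_orthogonal (hv : S.IsFutureCausal v)
    (hw : S.IsFutureCausal w) (hvw : S.g x v w = 0) :
    ∃ l m : TangentSpace (𝓡 2) x →ₗ[ℝ] ℝ, S.IsNullCoordinates x l m ∧
      l v = 0 ∧ l w = 0 ∧ 0 < m v ∧ 0 < m w := by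
  obtain ⟨l, m, h⟩ := S.exists_isNullCoordinates x
  obtain ⟨h1, h2, h5⟩ := h.of_future hv
  obtain ⟨h3, h4, h6⟩ := h.of_future hw
  rw [h.g_eq] at hvw
  have h7 := mul_nonneg h1 h4
  have h8 := mul_nonneg h2 h3
  have h9 : l v * m w = 0 := by linarith
  have h10 : m v * l w = 0 := by linarith
  rcases mul_eq_zero.1 h9 with h9 | h9
  · have hmv : 0 < m v := by linarith
    have hlw : l w = 0 := (mul_eq_zero.1 h10).resolve_left hmv.ne'
    exact ⟨l, m, h, h9, hlw, hmv, by linarith⟩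
  · have hlw : 0 < l w := by linarith
    have hmv : m v = 0 := (mul_eq_zero.1 h10).resolve_right hlw.ne'
    exact ⟨m, l, h.swap, hmv, h9, by linarith, hlw⟩

theorem exists_smul_of_orthogonal (hv : S.IsFutureCausal v)
    (hw : S.IsFutureCausal w) (hvw : S.g x v w = 0) : ∃ r : ℝ, 0 < r ∧ w = r • v := by
  obtain ⟨l, m, h, h1, h2, h3, h4⟩ := exists_isNullCoordinates_of_orthogonal hv hw hvw
  refine ⟨m w / m v, div_pos h4 h3, sub_eq_zero.1 (h.eq_zero _ ?_ ?_)⟩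
  · simp [h1, h2]
  · simp [h3.ne']

theorem g_self_eq_zero_of_orthogonal (hv : S.IsFutureCausal v)
    (hw : S.IsFutureCausal w) (hvw : S.g x v w = 0) : S.g x v v = 0 := by
  obtain ⟨l, m, h, h1, -⟩ := exists_isNullCoordinates_of_orthogonal hv hw hvw
  simp [h.g_eq, h1]

theorem orthogonal_trans (hv : S.IsFutureCausal v)
    (hw : S.IsFutureCausal w) (huv : S.g x u v = 0) (hvw : S.g x v w = 0) : S.g x u w = 0 := by
  obtain ⟨r, -, rfl⟩ := exists_smul_of_orthogonal hv hw hvw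
  simp [huv]

/-- There are only two null directions. -/
theorem orthogonal_of_three (hu0 : S.g x u u = 0) (hv0 : S.g x v v = 0) (hw0 : S.g x w w = 0) :
    S.g x u v = 0 ∨ S.g x u w = 0 ∨ S.g x v w = 0 := by
  obtain ⟨l, m, h⟩ := S.exists_isNullCoordinates x
  have key : ∀ {z : TangentSpace (𝓡 2) x}, S.g x z z = 0 → l z = 0 ∨ m z = 0 := by
    intro z hz
    rw [h.g_eq] at hz
    exact mul_eq_zero.1 (by linarith)
  simp only [h.g_eq]
  rcases key hu0 with h1 | h1 <;> rcases key hv0 with h2 | h2 <;> rcases key hw0 with h3 | h3 <;>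
    simp [h1, h2, h3]

end LinearAlgebra

/-- Tangent vectors at the same point with vanishing product; for future directed causal vectors
this means that they span the same null line. -/
def Orthogonal (S : Spacetime 2 M) (q q' : TangentBundle (𝓡 2) M) : Prop :=
  ∃ (x : M) (v w : TangentSpace (𝓡 2) x), q = ⟨x, v⟩ ∧ q' = ⟨x, w⟩ ∧ S.g x v w = 0

theorem Orthogonal.symm {q q' : TangentBundle (𝓡 2) M} (h : S.Orthogonal q q') :
    S.Orthogonal q' q := by
  obtain ⟨x, v, w, rfl, rfl, h⟩ := h
  exact ⟨x, w, v, rfl, rfl, by rw [g_symm, h]⟩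

/-- Orthogonality is not transitive in general; here the last two vectors are future causal, so
being orthogonal makes them proportional. -/
theorem Orthogonal.trans {q₁ q₂ q₃ : TangentBundle (𝓡 2) M} (h : S.Orthogonal q₁ q₂)
    (h' : S.Orthogonal q₂ q₃) (h₂ : S.IsFutureCausal q₂.2)
    (h₃ : S.IsFutureCausal q₃.2) : S.Orthogonal q₁ q₃ := by
  obtain ⟨x, u, v, rfl, rfl, h⟩ := h
  obtain ⟨x', v', w, hv, rfl, h'⟩ := h'
  obtain rfl : x = x' := congrArg TotalSpace.proj hv
  obtain rfl : v = v' := by simpa using hv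
  exact ⟨x, u, w, rfl, rfl, orthogonal_trans h₂ h₃ h h'⟩

theorem Orthogonal.proj_eq {q q' : TangentBundle (𝓡 2) M} (h : S.Orthogonal q q') :
    q.proj = q'.proj := by
  obtain ⟨x, v, w, rfl, rfl, h⟩ := h
  rfl

theorem orthogonal_iff_chart {x₀ : M} {q q' : TangentBundle (𝓡 2) M} (h : q.proj = q'.proj)
    (hq : q.proj ∈ (chartAt 𝔼² x₀).source) :
    S.Orthogonal q q' ↔ S.chartMetric x₀ (extChartAt (𝓡 2) x₀ q.proj) (toChart x₀ q.proj q.2)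
      (toChart x₀ q'.proj q'.2) = 0 := by
  obtain ⟨x, v⟩ := q
  obtain ⟨y, w⟩ := q'
  obtain rfl : x = y := h
  rw [chartMetric_toChart hq]
  constructor
  · rintro ⟨x', v', w', hv, hw, h⟩
    obtain rfl : x = x' := congrArg TotalSpace.proj hv
    obtain rfl : v = v' := by simpa using hv
    obtain rfl : w = w' := by simpa using hw
    exact h
  · exact fun h ↦ ⟨x, v, w, rfl, rfl, h⟩

/-- A curve with null velocities on `[a, b)`. -/
def IsNullOn (S : Spacetime 2 M) (γ : ℝ → M) (a b : ℝ) : Prop :=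
  ∀ s ∈ Ico a b, S.g (γ s) (velocity 2 γ a b s) (velocity 2 γ a b s) = 0

theorem IsNullOn.mono {γ : ℝ → M} {a b a' b' : ℝ} (hn : S.IsNullOn γ a b)
    (hγ : S.IsSmoothCausalOn γ a b) (ha : a ≤ a') (hb : b' ≤ b) (hab : a' < b') :
    S.IsNullOn γ a' b' := by
  intro s hs
  rw [velocity_subinterval hγ.1 ha hb hab (Ico_subset_Icc_self hs)]
  exact hn s (Ico_subset_Ico ha hb hs)

theorem velocityLift_subinterval {γ : ℝ → M} {a b a' b' s : ℝ}
    (hγ : S.IsSmoothCausalOn γ a b) (ha : a ≤ a') (hb : b' ≤ b) (hab : a' < b')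
    (hs : s ∈ Icc a' b') : velocityLift 2 γ a' b' s = velocityLift 2 γ a b s := by
  rw [velocityLift, velocityLift, velocity_subinterval hγ.1 ha hb hab hs]

/-- A linear form in the chart that grows along a null vector and whose kernel is transversal to
it. -/
theorem exists_transversal {x : M} {v : TangentSpace (𝓡 2) x} (hv : S.IsFutureCausal v)
    (hv0 : S.g x v v = 0) :
    ∃ (τ : 𝔼² →L[ℝ] ℝ) (κ : ℝ), 0 < τ (toChart x x v) ∧ 0 < κ ∧ ∀ u, τ u = 0 →
      κ * ‖u‖ ≤ |S.chartMetric x (extChartAt (𝓡 2) x x) (toChart x x v) u| := by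
  have hx : x ∈ (chartAt 𝔼² x).source := mem_chart_source _ _
  -- On the null line of `v` the coordinate `l` vanishes, so `τ` is `m`. On its kernel the product
  -- with `v` is `-(m v) * l u`, and `l` bounds the norm there because `(l, m)` is injective.
  obtain ⟨l, m, h, hl, -, hm, -⟩ := exists_isNullCoordinates_of_orthogonal hv hv hv0
  set e : 𝔼² →ₗ[ℝ] TangentSpace (𝓡 2) x := (ofChart x x).toLinearMap with he
  have hker : LinearMap.ker ((l ∘ₗ e).prod (m ∘ₗ e)) = ⊥ := by
    rw [LinearMap.ker_eq_bot']
    intro u hu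
    have h1 : ofChart x x u = 0 :=
      h.eq_zero _ (congrArg Prod.fst hu) (congrArg Prod.snd hu)
    rw [← toChart_ofChart hx u, h1, map_zero]
  obtain ⟨K, hK, hanti⟩ := LinearMap.exists_antilipschitzWith _ hker
  refine ⟨LinearMap.toContinuousLinearMap (m ∘ₗ e), m v / K, ?_, div_pos hm hK, fun u hu ↦ ?_⟩
  · simpa [he, ofChart_toChart hx] using hm
  · have hu' : m (ofChart x x u) = 0 := hu
    rw [chartMetric_apply hx, ofChart_toChart hx, h.g_eq, hl, hu', zero_mul, zero_add, abs_neg,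
      abs_mul, abs_of_pos hm]
    have h2 : ‖u‖ ≤ K * ‖((l (ofChart x x u), m (ofChart x x u)) : ℝ × ℝ)‖ :=
      hanti.le_mul_norm (map_zero _) u
    rw [hu', Prod.norm_mk, norm_zero, max_eq_left (norm_nonneg _), Real.norm_eq_abs] at h2
    calc m v / K * ‖u‖ ≤ m v / K * (K * |l (ofChart x x u)|) := by gcongr
      _ = m v * |l (ofChart x x u)| := by
        have : (K : ℝ) ≠ 0 := by positivity
        field_simp

theorem toChart_velocityLift {x₀ : M} {γ : ℝ → M} {a b s : ℝ} (hab : a < b)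
    (hγ : S.IsSmoothCausalOn γ a b) (hs : s ∈ Icc a b) (hx : γ s ∈ (chartAt 𝔼² x₀).source) :
    derivWithin (fun s ↦ extChartAt (𝓡 2) x₀ (γ s)) (Icc a b) s =
      toChart x₀ (velocityLift 2 γ a b s).proj (velocityLift 2 γ a b s).2 :=
  derivWithin_chart_comp hab hγ.1 hs hx

/-- Null curves with the same initial point and null direction meet again, with the same
direction. -/
theorem exists_orthogonal_of_orthogonal {γ₁ γ₂ : ℝ → M} {a₁ b₁ a₂ b₂ : ℝ} (hab₁ : a₁ < b₁)
    (hab₂ : a₂ < b₂) (hγ₁ : S.IsSmoothCausalOn γ₁ a₁ b₁) (hγ₂ : S.IsSmoothCausalOn γ₂ a₂ b₂)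
    (hn₁ : S.IsNullOn γ₁ a₁ b₁) (hn₂ : S.IsNullOn γ₂ a₂ b₂)
    (h : S.Orthogonal (velocityLift 2 γ₁ a₁ b₁ a₁) (velocityLift 2 γ₂ a₂ b₂ a₂)) :
    ∃ s ∈ Ioo a₁ b₁, ∃ t ∈ Ioo a₂ b₂,
      S.Orthogonal (velocityLift 2 γ₁ a₁ b₁ s) (velocityLift 2 γ₂ a₂ b₂ t) := by
  obtain ⟨x, v, w, hv, hw, hvw⟩ := h
  have hx₁ : γ₁ a₁ = x := congrArg TotalSpace.proj hv
  have hx₂ : γ₂ a₂ = x := congrArg TotalSpace.proj hw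
  have hfv : S.IsFutureCausal v := by
    have h1 : S.IsFutureCausal (velocityLift 2 γ₁ a₁ b₁ a₁).2 := hγ₁.2 a₁ (left_mem_Icc.2 hab₁.le)
    rwa [hv] at h1
  have hfw : S.IsFutureCausal w := by
    have h1 : S.IsFutureCausal (velocityLift 2 γ₂ a₂ b₂ a₂).2 := hγ₂.2 a₂ (left_mem_Icc.2 hab₂.le)
    rwa [hw] at h1
  -- Cutting strictly before `b` matters: nullity is known on the half-open interval, but
  -- `exists_common_point` asks for it on a closed one.
  have hnear : ∀ {γ : ℝ → M} {a b : ℝ}, a < b → S.IsSmoothCausalOn γ a b → γ a = x →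
      ∃ b', a < b' ∧ b' < b ∧ ∀ s ∈ Icc a b', γ s ∈ (chartAt 𝔼² x).source := by
    intro γ a b hab hγ hγa
    obtain ⟨c, hac, hcb⟩ := _root_.exists_between hab
    obtain ⟨b', h1, h2, h3⟩ := exists_subinterval_source hac
      (hγ.1.continuousOn.mono (Icc_subset_Icc_right hcb.le))
      (U := (chartAt 𝔼² x).source) (by rw [hγa]; exact chart_source_mem_nhds _ _)
    exact ⟨b', h1, h2.trans_lt hcb, h3⟩
  obtain ⟨b₁', hab₁', hb₁', hsrc₁⟩ := hnear hab₁ hγ₁ hx₁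
  obtain ⟨b₂', hab₂', hb₂', hsrc₂⟩ := hnear hab₂ hγ₂ hx₂
  have hγ₁' := hγ₁.mono le_rfl hb₁'.le hab₁'
  have hγ₂' := hγ₂.mono le_rfl hb₂'.le hab₂'
  have hnull : ∀ {γ : ℝ → M} {a b b' : ℝ}, a < b' → b' < b → S.IsSmoothCausalOn γ a b →
      S.IsNullOn γ a b → (∀ s ∈ Icc a b', γ s ∈ (chartAt 𝔼² x).source) →
      ∀ s ∈ Icc a b', S.chartMetric x (extChartAt (𝓡 2) x (γ s))
        (derivWithin (fun s ↦ extChartAt (𝓡 2) x (γ s)) (Icc a b') s)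
        (derivWithin (fun s ↦ extChartAt (𝓡 2) x (γ s)) (Icc a b') s) = 0 := by
    intro γ a b b' hab hb hγ hn hsrc s hs
    rw [derivWithin_chart_comp hab (hγ.mono le_rfl hb.le hab).1 hs (hsrc s hs),
      chartMetric_toChart (hsrc s hs), velocity_subinterval hγ.1 le_rfl hb.le hab hs]
    exact hn s ⟨hs.1, hs.2.trans_lt hb⟩
  have hd₁ : derivWithin (fun s ↦ extChartAt (𝓡 2) x (γ₁ s)) (Icc a₁ b₁') a₁ = toChart x x v := by
    rw [toChart_velocityLift hab₁' hγ₁' (left_mem_Icc.2 hab₁'.le)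
      (hsrc₁ _ (left_mem_Icc.2 hab₁'.le)),
      velocityLift_subinterval hγ₁ le_rfl hb₁'.le hab₁' (left_mem_Icc.2 hab₁'.le), hv]
  have hd₂ : derivWithin (fun s ↦ extChartAt (𝓡 2) x (γ₂ s)) (Icc a₂ b₂') a₂ = toChart x x w := by
    rw [toChart_velocityLift hab₂' hγ₂' (left_mem_Icc.2 hab₂'.le)
      (hsrc₂ _ (left_mem_Icc.2 hab₂'.le)),
      velocityLift_subinterval hγ₂ le_rfl hb₂'.le hab₂' (left_mem_Icc.2 hab₂'.le), hw]
  obtain ⟨r, hr, hrw⟩ := exists_smul_of_orthogonal hfv hfw hvw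
  obtain ⟨τ, κ, hτ, hκ, hκτ⟩ := exists_transversal hfv (g_self_eq_zero_of_orthogonal hfv hfw hvw)
  obtain ⟨s, hs, t, ht, hst, r', hr', hpar⟩ := exists_common_point hab₁' hab₂'
    (c₁ := fun s ↦ extChartAt (𝓡 2) x (γ₁ s)) (c₂ := fun s ↦ extChartAt (𝓡 2) x (γ₂ s))
    (p₀ := extChartAt (𝓡 2) x x) (by simp only [hx₁]) (by simp only [hx₂])
    (extChartAt_target_mem_nhds (I := 𝓡 2) x)
    ((contDiffAt_chartMetric S x).of_le (show (1 : WithTop ℕ∞) ≤ ∞ by simp))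
    (fun p hp ↦ chartMetric_symm hp) (contDiffOn_chart_comp hγ₁'.1 hsrc₁)
    (contDiffOn_chart_comp hγ₂'.1 hsrc₂) (hnull hab₁' hb₁' hγ₁ hn₁ hsrc₁)
    (hnull hab₂' hb₂' hγ₂ hn₂ hsrc₂) hr (by rw [hd₁, hd₂, hrw, map_smul]) τ
    (by rw [hd₁]; exact hτ) hκ (by rw [hd₁]; exact hκτ)
  have hsI := Ioo_subset_Icc_self hs
  have htI := Ioo_subset_Icc_self ht
  refine ⟨s, ⟨hs.1, hs.2.trans hb₁'⟩, t, ⟨ht.1, ht.2.trans hb₂'⟩, ?_⟩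
  rw [← velocityLift_subinterval hγ₁ le_rfl hb₁'.le hab₁' hsI,
    ← velocityLift_subinterval hγ₂ le_rfl hb₂'.le hab₂' htI]
  have hmeet : γ₁ s = γ₂ t := (extChartAt (𝓡 2) x).injOn
    (by rw [extChartAt_source_eq]; exact hsrc₁ s hsI)
    (by rw [extChartAt_source_eq]; exact hsrc₂ t htI) hst
  rw [orthogonal_iff_chart (x₀ := x) hmeet (hsrc₁ s hsI),
    ← toChart_velocityLift hab₁' hγ₁' hsI (hsrc₁ s hsI),
    ← toChart_velocityLift hab₂' hγ₂' htI (hsrc₂ t htI), hpar, map_smul]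
  have h0 := hnull hab₁' hb₁' hγ₁ hn₁ hsrc₁ s hsI
  exact (congrArg (r' • ·) h0).trans (smul_zero _)

theorem continuousWithinAt_derivWithin_chart_comp {x₀ : M} {γ : ℝ → M} {a b s : ℝ} (hab : a < b)
    (hγ : S.IsSmoothCausalOn γ a b) (hs : s ∈ Icc a b) (hx : γ s ∈ (chartAt 𝔼² x₀).source) :
    ContinuousWithinAt (derivWithin (fun s ↦ extChartAt (𝓡 2) x₀ (γ s)) (Icc a b)) (Icc a b) s := by
  have h1 : ContMDiffWithinAt 𝓘(ℝ, ℝ) 𝓘(ℝ, 𝔼²) ∞ (fun s ↦ extChartAt (𝓡 2) x₀ (γ s))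
      (Icc a b) s :=
    (contMDiffAt_extChartAt' (I := 𝓡 2) (n := ∞) hx).comp_contMDiffWithinAt s (hγ.1 s hs)
  have h2 := h1.contDiffWithinAt.fderivWithin_right (m := 0) (uniqueDiffOn_Icc hab) (by simp) hs
  exact h2.continuousWithinAt.clm_apply continuousWithinAt_const

/-- Limits of meeting parameters are meeting parameters because `M` is Hausdorff; the vanishing
product then passes to the limit in one chart around the limit point. This provides the compactness
for continuing a coincidence. -/
theorem isClosed_orthogonal [T2Space M] {γ₁ γ₂ : ℝ → M} {a₁ b₁ a₂ b₂ : ℝ} (hab₁ : a₁ < b₁)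
    (hab₂ : a₂ < b₂) (hγ₁ : S.IsSmoothCausalOn γ₁ a₁ b₁) (hγ₂ : S.IsSmoothCausalOn γ₂ a₂ b₂) :
    IsClosed {z : ℝ × ℝ | z ∈ Icc a₁ b₁ ×ˢ Icc a₂ b₂ ∧
      S.Orthogonal (velocityLift 2 γ₁ a₁ b₁ z.1) (velocityLift 2 γ₂ a₂ b₂ z.2)} := by
  set P := {z : ℝ × ℝ | z ∈ Icc a₁ b₁ ×ˢ Icc a₂ b₂ ∧
      S.Orthogonal (velocityLift 2 γ₁ a₁ b₁ z.1) (velocityLift 2 γ₂ a₂ b₂ z.2)} with hP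
  have hQ : IsClosed {z : ℝ × ℝ | z ∈ Icc a₁ b₁ ×ˢ Icc a₂ b₂ ∧ γ₁ z.1 = γ₂ z.2} := by
    have hc : ContinuousOn (fun z : ℝ × ℝ ↦ (γ₁ z.1, γ₂ z.2)) (Icc a₁ b₁ ×ˢ Icc a₂ b₂) :=
      (hγ₁.1.continuousOn.comp continuousOn_fst fun z hz ↦ hz.1).prodMk
        (hγ₂.1.continuousOn.comp continuousOn_snd fun z hz ↦ hz.2)
    exact hc.preimage_isClosed_of_isClosed (isClosed_Icc.prod isClosed_Icc) isClosed_diagonal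
  have hPQ : P ⊆ {z : ℝ × ℝ | z ∈ Icc a₁ b₁ ×ˢ Icc a₂ b₂ ∧ γ₁ z.1 = γ₂ z.2} :=
    fun z hz ↦ ⟨hz.1, hz.2.proj_eq⟩
  refine isClosed_of_closure_subset fun z hz ↦ ?_
  obtain ⟨hzI, hzeq⟩ : z ∈ Icc a₁ b₁ ×ˢ Icc a₂ b₂ ∧ γ₁ z.1 = γ₂ z.2 :=
    closure_minimal hPQ hQ hz
  refine ⟨hzI, ?_⟩
  obtain ⟨x₀, hx₀⟩ : ∃ x₀, γ₁ z.1 = x₀ := ⟨_, rfl⟩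
  have hx₁ : γ₁ z.1 ∈ (chartAt 𝔼² x₀).source := by rw [hx₀]; exact mem_chart_source _ _
  have hx₂ : γ₂ z.2 ∈ (chartAt 𝔼² x₀).source := hzeq ▸ hx₁
  have hf : Tendsto Prod.fst (𝓝[P] z) (𝓝[Icc a₁ b₁] z.1) :=
    tendsto_nhdsWithin_iff.2 ⟨continuousAt_fst.tendsto.mono_left nhdsWithin_le_nhds,
      eventually_nhdsWithin_of_forall fun z hz ↦ hz.1.1⟩
  have hs : Tendsto Prod.snd (𝓝[P] z) (𝓝[Icc a₂ b₂] z.2) :=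
    tendsto_nhdsWithin_iff.2 ⟨continuousAt_snd.tendsto.mono_left nhdsWithin_le_nhds,
      eventually_nhdsWithin_of_forall fun z hz ↦ hz.1.2⟩
  have h₁ := (continuousWithinAt_derivWithin_chart_comp hab₁ hγ₁ hzI.1 hx₁).tendsto.comp hf
  have h₂ := (continuousWithinAt_derivWithin_chart_comp hab₂ hγ₂ hzI.2 hx₂).tendsto.comp hs
  have hγ : Tendsto (fun y : ℝ × ℝ ↦ γ₁ y.1) (𝓝[P] z) (𝓝 x₀) := by
    rw [← hx₀]
    exact (hγ₁.1.continuousOn z.1 hzI.1).tendsto.comp hf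
  have hG : ContinuousWithinAt
      (fun y : ℝ × ℝ ↦ S.chartMetric x₀ (extChartAt (𝓡 2) x₀ (γ₁ y.1))) P z := by
    rw [ContinuousWithinAt, hx₀]
    exact (continuousAt_chartMetric S x₀).tendsto.comp
      ((continuousAt_extChartAt (I := 𝓡 2) x₀).tendsto.comp hγ)
  have hlim := ((hG.clm_apply h₁).clm_apply h₂).tendsto
  have hzero : ∀ᶠ y in 𝓝[P] z, S.chartMetric x₀ (extChartAt (𝓡 2) x₀ (γ₁ y.1))
      (derivWithin (fun s ↦ extChartAt (𝓡 2) x₀ (γ₁ s)) (Icc a₁ b₁) y.1)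
      (derivWithin (fun s ↦ extChartAt (𝓡 2) x₀ (γ₂ s)) (Icc a₂ b₂) y.2) = 0 := by
    filter_upwards [hγ.eventually_mem (chart_source_mem_nhds 𝔼² x₀), self_mem_nhdsWithin]
      with y hy hyP
    have hy' : γ₁ y.1 = γ₂ y.2 := hyP.2.proj_eq
    rw [toChart_velocityLift hab₁ hγ₁ hyP.1.1 hy,
      toChart_velocityLift hab₂ hγ₂ hyP.1.2 (hy' ▸ hy)]
    exact (orthogonal_iff_chart hyP.2.proj_eq hy).1 hyP.2
  have : (𝓝[P] z).NeBot := mem_closure_iff_nhdsWithin_neBot.1 hz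
  have hval := tendsto_nhds_unique (hlim.congr' hzero) tendsto_const_nhds
  rw [orthogonal_iff_chart hzeq hx₁, ← toChart_velocityLift hab₁ hγ₁ hzI.1 hx₁,
    ← toChart_velocityLift hab₂ hγ₂ hzI.2 hx₂]
  exact hval

/-- Of two null curves with the same initial point and null direction, one runs along the other to
its end. -/
theorem exists_orthogonal_end [T2Space M] {γ₁ γ₂ : ℝ → M} {a₁ b₁ a₂ b₂ : ℝ} (hab₁ : a₁ < b₁)
    (hab₂ : a₂ < b₂) (hγ₁ : S.IsSmoothCausalOn γ₁ a₁ b₁) (hγ₂ : S.IsSmoothCausalOn γ₂ a₂ b₂)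
    (hn₁ : S.IsNullOn γ₁ a₁ b₁) (hn₂ : S.IsNullOn γ₂ a₂ b₂)
    (h : S.Orthogonal (velocityLift 2 γ₁ a₁ b₁ a₁) (velocityLift 2 γ₂ a₂ b₂ a₂)) :
    (∃ t ∈ Icc a₂ b₂, S.Orthogonal (velocityLift 2 γ₁ a₁ b₁ b₁) (velocityLift 2 γ₂ a₂ b₂ t)) ∨
    ∃ s ∈ Icc a₁ b₁, S.Orthogonal (velocityLift 2 γ₁ a₁ b₁ s) (velocityLift 2 γ₂ a₂ b₂ b₂) := by
  have hcpt := (isCompact_Icc.prod isCompact_Icc).of_isClosed_subset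
    (isClosed_orthogonal hab₁ hab₂ hγ₁ hγ₂) fun z hz ↦ hz.1
  -- Take a tangency that maximizes the sum of the two parameters. If neither curve has ended, local
  -- uniqueness yields a later tangency with a larger sum.
  obtain ⟨z, ⟨hzI, hz⟩, hmax⟩ := hcpt.exists_isMaxOn
    ⟨(a₁, a₂), ⟨left_mem_Icc.2 hab₁.le, left_mem_Icc.2 hab₂.le⟩, h⟩
    (f := fun z : ℝ × ℝ ↦ z.1 + z.2) (by fun_prop)
  rcases hzI.1.2.eq_or_lt with h1 | h1
  · exact Or.inl ⟨z.2, hzI.2, h1 ▸ hz⟩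
  rcases hzI.2.2.eq_or_lt with h2 | h2
  · exact Or.inr ⟨z.1, hzI.1, h2 ▸ hz⟩
  exfalso
  have hz' := hz
  rw [← velocityLift_subinterval hγ₁ hzI.1.1 le_rfl h1 (left_mem_Icc.2 h1.le),
    ← velocityLift_subinterval hγ₂ hzI.2.1 le_rfl h2 (left_mem_Icc.2 h2.le)] at hz'
  obtain ⟨s, hs, t, ht, hst⟩ := exists_orthogonal_of_orthogonal h1 h2
    (hγ₁.mono hzI.1.1 le_rfl h1) (hγ₂.mono hzI.2.1 le_rfl h2)
    (hn₁.mono hγ₁ hzI.1.1 le_rfl h1) (hn₂.mono hγ₂ hzI.2.1 le_rfl h2) hz'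
  rw [velocityLift_subinterval hγ₁ hzI.1.1 le_rfl h1 (Ioo_subset_Icc_self hs),
    velocityLift_subinterval hγ₂ hzI.2.1 le_rfl h2 (Ioo_subset_Icc_self ht)] at hst
  have hle : s + t ≤ z.1 + z.2 := hmax (a := (s, t))
    ⟨⟨⟨hzI.1.1.trans hs.1.le, hs.2.le⟩, ⟨hzI.2.1.trans ht.1.le, ht.2.le⟩⟩, hst⟩
  linarith [hs.1, ht.1]

end Spacetime

/-! ### Null chains and the frame condition -/

namespace Spacetime

open Filter Topology

variable {M : Type*} [TopologicalSpace M]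
    [ChartedSpace (EuclideanSpace ℝ (Fin 2)) M] [IsManifold (𝓡 2) ∞ M]
    {S : Spacetime 2 M}

/-- `NullChain S n q y`: there is a null curve without corners, with `n` smooth pieces, that
continues the tangent vector `q` and ends at `y`. -/
def NullChain (S : Spacetime 2 M) : ℕ → TangentBundle (𝓡 2) M → M → Prop
  | 0, q, y => q.proj = y
  | n + 1, q, y => ∃ (γ : ℝ → M) (a b : ℝ), a < b ∧ S.IsSmoothCausalOn γ a b ∧ S.IsNullOn γ a b ∧
      S.Orthogonal q (velocityLift 2 γ a b a) ∧ NullChain S n (velocityLift 2 γ a b b) y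

theorem NullChain.eq_or_after {n : ℕ} {q : TangentBundle (𝓡 2) M} {y : M}
    (h : S.NullChain n q y) : q.proj = y ∨ S.After q.proj y := by
  induction n generalizing q with
  | zero => exact Or.inl h
  | succ n ih =>
    obtain ⟨γ, a, b, hab, hγ, -, hq, h⟩ := h
    have h1 : S.After (γ a) (γ b) := hγ.after le_rfl hab le_rfl
    have hq' : q.proj = γ a := hq.proj_eq
    rw [hq']
    rcases ih h with h2 | h2
    · exact Or.inr (h2 ▸ h1)
    · exact Or.inr (h1.trans h2)

theorem IsSmoothCausalOn.isFutureCausal {γ : ℝ → M} {a b s : ℝ} (hγ : S.IsSmoothCausalOn γ a b)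
    (hs : s ∈ Icc a b) : S.IsFutureCausal (velocityLift 2 γ a b s).2 :=
  hγ.2 s hs

theorem IsNullOn.orthogonal_self {γ : ℝ → M} {a b s : ℝ} (hn : S.IsNullOn γ a b)
    (hs : s ∈ Ico a b) :
    S.Orthogonal (velocityLift 2 γ a b s) (velocityLift 2 γ a b s) :=
  ⟨γ s, _, _, rfl, rfl, hn s hs⟩

/-- The rest of a null chain after a point of its first piece. -/
theorem NullChain.of_le {γ : ℝ → M} {a b s : ℝ} {n : ℕ} {y : M} (hγ : S.IsSmoothCausalOn γ a b)
    (hn : S.IsNullOn γ a b) (hs : s ∈ Icc a b) (h : S.NullChain n (velocityLift 2 γ a b b) y) :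
    ∃ m ≤ n + 1, S.NullChain m (velocityLift 2 γ a b s) y := by
  rcases hs.2.eq_or_lt with rfl | hsb
  · exact ⟨n, n.le_succ, h⟩
  refine ⟨n + 1, le_rfl, γ, s, b, hsb, hγ.mono hs.1 le_rfl hsb, hn.mono hγ hs.1 le_rfl hsb, ?_, ?_⟩
  · rw [velocityLift_subinterval hγ hs.1 le_rfl hsb (left_mem_Icc.2 hsb.le)]
    exact hn.orthogonal_self ⟨hs.1, hsb⟩
  · rwa [velocityLift_subinterval hγ hs.1 le_rfl hsb (right_mem_Icc.2 hsb.le)]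

/-- The end points of two null chains with the same initial direction are comparable. -/
theorem NullChain.comparable [T2Space M] {n₁ n₂ : ℕ} {q₁ q₂ : TangentBundle (𝓡 2) M} {y₁ y₂ : M}
    (h₁ : S.NullChain n₁ q₁ y₁) (h₂ : S.NullChain n₂ q₂ y₂) (hq : S.Orthogonal q₁ q₂)
    (hq₁ : S.IsFutureCausal q₁.2) (hq₂ : S.IsFutureCausal q₂.2) :
    y₁ = y₂ ∨ S.After y₁ y₂ ∨ S.After y₂ y₁ := by
  induction hN : n₁ + n₂ using Nat.strong_induction_on generalizing n₁ n₂ q₁ q₂ with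
  | _ N ih =>
    rcases n₁ with _ | n₁
    · obtain rfl : q₁.proj = y₁ := h₁
      rw [hq.proj_eq]
      exact h₂.eq_or_after.imp id Or.inl
    rcases n₂ with _ | n₂
    · obtain rfl : q₂.proj = y₂ := h₂
      rw [← hq.proj_eq]
      exact h₁.eq_or_after.imp Eq.symm Or.inr
    obtain ⟨γ₁, a₁, b₁, hab₁, hγ₁, hn₁, ho₁, hc₁⟩ := h₁
    obtain ⟨γ₂, a₂, b₂, hab₂, hγ₂, hn₂, ho₂, hc₂⟩ := h₂
    have hv₁ := hγ₁.isFutureCausal (left_mem_Icc.2 hab₁.le)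
    have hv₂ := hγ₂.isFutureCausal (left_mem_Icc.2 hab₂.le)
    have ho := (ho₁.symm.trans hq hq₁ hq₂).trans ho₂ hq₂ hv₂
    -- One first piece is used up along the other. Its chain loses a piece and the other chain gains
    -- none, so the total number of pieces drops.
    rcases exists_orthogonal_end hab₁ hab₂ hγ₁ hγ₂ hn₁ hn₂ ho with ⟨t, ht, hot⟩ | ⟨s, hs, hos⟩
    · obtain ⟨m, hm, hc⟩ := NullChain.of_le hγ₂ hn₂ ht hc₂
      exact ih (n₁ + m) (by omega) hc₁ hc hot (hγ₁.isFutureCausal (right_mem_Icc.2 hab₁.le))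
        (hγ₂.isFutureCausal ht) rfl
    · obtain ⟨m, hm, hc⟩ := NullChain.of_le hγ₁ hn₁ hs hc₁
      exact ih (m + n₂) (by omega) hc hc₂ hos (hγ₁.isFutureCausal hs)
        (hγ₂.isFutureCausal (right_mem_Icc.2 hab₂.le)) rfl

theorem IsSmoothCausalOn.mem_past_of_between {γ : ℝ → M} {a b s : ℝ} {p y : M}
    (hγ : S.IsSmoothCausalOn γ a b) (hs : s ∈ Icc a b) (hp : γ s ∈ S.past p)
    (hy : p = y ∨ S.After p y) : γ a ∈ S.past y := by
  have h1 : γ s ∈ S.past y := by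
    rcases hy with rfl | hy
    · exact hp
    · exact past_subset_past hy hp
  rcases hs.1.eq_or_lt with rfl | has
  · exact h1
  · exact (hγ.after le_rfl has hs.2).mem_past h1

theorem IsSmoothCausalOn.eq_or_after {γ : ℝ → M} {a b s : ℝ} {y : M}
    (hγ : S.IsSmoothCausalOn γ a b) (hs : s ∈ Icc a b) (hy : γ b = y ∨ S.After (γ b) y) :
    γ s = y ∨ S.After (γ s) y := by
  rcases hs.2.eq_or_lt with rfl | hsb
  · exact hy
  · have h1 := hγ.after hs.1 hsb le_rfl
    rcases hy with rfl | hy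
    · exact Or.inr h1
    · exact Or.inr (h1.trans hy)

/-- A timelike velocity at `s` would put `γ s` in the past of a later point of the curve, and
push-up would put `γ a` in the past of `y`. The argument needs curve after `s`, hence the half-open
interval. -/
theorem IsSmoothCausalOn.isNullOn {γ : ℝ → M} {a b : ℝ} {y : M}
    (hγ : S.IsSmoothCausalOn γ a b) (hy : γ b = y ∨ S.After (γ b) y) (hx : γ a ∉ S.past y) :
    S.IsNullOn γ a b := by
  intro s hs
  by_contra hne
  have hlt := lt_of_le_of_ne (hγ.2 s (Ico_subset_Icc_self hs)).1.2 hne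
  have hγ' := hγ.mono hs.1 le_rfl hs.2
  have hlt' : S.g (γ s) (velocity 2 γ s b s) (velocity 2 γ s b s) < 0 := by
    rw [velocity_subinterval hγ.1 hs.1 le_rfl hs.2 (left_mem_Icc.2 hs.2.le)]
    exact hlt
  obtain ⟨t, ht, hst⟩ := hγ'.exists_mem_past_of_timelike hs.2 hlt'
  exact hx (hγ.mem_past_of_between (Ico_subset_Icc_self hs) hst
    (hγ'.eq_or_after (Ioc_subset_Icc_self ht) hy))

/-- A causal relation that is not chronological is given by a null curve without corners. -/
theorem After.exists_nullChain {x y : M} (h : S.After x y) (hx : x ∉ S.past y) :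
    ∃ (γ : ℝ → M) (a b : ℝ) (n : ℕ), a < b ∧ S.IsSmoothCausalOn γ a b ∧ S.IsNullOn γ a b ∧
      γ a = x ∧ S.NullChain n (velocityLift 2 γ a b b) y := by
  rw [after_iff_transGen] at h
  induction h using Relation.TransGen.head_induction_on with
  | single h =>
    obtain ⟨γ, a, b, hab, hγ, rfl, hb⟩ := h
    exact ⟨γ, a, b, 0, hab, hγ, hγ.isNullOn (Or.inl hb) hx, rfl, hb⟩
  | head h hzy ih =>
    obtain ⟨γ, a, b, hab, hγ, rfl, rfl⟩ := h
    have hzy' := after_iff_transGen.2 hzy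
    have hz : γ b ∉ S.past y := fun h ↦ hx ((hγ.after le_rfl hab le_rfl).mem_past h)
    obtain ⟨η, a', b', n, hab', hη, hηn, hηa, hc⟩ := ih hz
    refine ⟨γ, a, b, n + 1, hab, hγ, hγ.isNullOn (Or.inr hzy') hx, rfl,
      η, a', b', hab', hη, hηn, ?_, hc⟩
    obtain ⟨w, hw⟩ : ∃ w : TangentSpace (𝓡 2) (γ b), velocityLift 2 η a' b' a' = ⟨γ b, w⟩ := by
      rw [← hηa]; exact ⟨_, rfl⟩
    have hwf : S.IsFutureCausal w := by
      have h1 := hη.isFutureCausal (left_mem_Icc.2 hab'.le)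
      rwa [hw] at h1
    refine ⟨γ b, velocity 2 γ a b b, w, rfl, hw, ?_⟩
    -- A nonzero product of future causal vectors is negative, so it is a corner that can be cut,
    -- contrary to `hx`.
    by_contra hne
    have hlt := lt_of_le_of_ne (g_nonpos (hγ.isFutureCausal (right_mem_Icc.2 hab.le)) hwf) hne
    obtain ⟨s, hs, t, ht, hst⟩ := hγ.exists_mem_past_of_corner hab hab' hη rfl hw hlt
    exact hx (hγ.mem_past_of_between (Ico_subset_Icc_self hs) hst
      (hη.eq_or_after (Ioc_subset_Icc_self ht) hc.eq_or_after))

/-- The past is open, so a short initial piece of the curve to `z` stays in it. -/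
theorem exists_after_of_mem_past {x y z : M} (hx : x ∈ S.past y) (hz : S.After x z) :
    ∃ w, S.After x w ∧ S.After w z ∧ S.After w y := by
  obtain ⟨γ, a, b, hab, hγ, rfl, hb⟩ := hz.exists_smooth_start
  obtain ⟨b', hab', hb', hsub⟩ := exists_subinterval_source hab hγ.1.continuousOn
    (isOpen_interior.mem_nhds hx)
  obtain ⟨s, hs⟩ := _root_.exists_between hab'
  have hwy : S.After (γ s) y := after_of_mem_past (hsub s (Ioo_subset_Icc_self hs))
  have hwb := hγ.after hs.1.le (hs.2.trans_le hb') le_rfl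
  refine ⟨γ s, hγ.after le_rfl hs.1 (hs.2.le.trans hb'), ?_, hwy⟩
  rcases hb with rfl | hb
  · exact hwb
  · exact hwb.trans hb

/-- The witness is a point that both null curves pass after their common start. -/
theorem exists_after_of_orthogonal {γ η : ℝ → M} {a b a' b' : ℝ} {n m : ℕ} {y z : M}
    (hab : a < b) (hab' : a' < b') (hγ : S.IsSmoothCausalOn γ a b)
    (hη : S.IsSmoothCausalOn η a' b') (hγn : S.IsNullOn γ a b) (hηn : S.IsNullOn η a' b')
    (hy : S.NullChain n (velocityLift 2 γ a b b) y)
    (hz : S.NullChain m (velocityLift 2 η a' b' b') z)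
    (h : S.Orthogonal (velocityLift 2 γ a b a) (velocityLift 2 η a' b' a')) :
    ∃ w, S.After (γ a) w ∧ S.After w z ∧ S.After w y := by
  obtain ⟨s, hs, t, ht, hst⟩ := exists_orthogonal_of_orthogonal hab hab' hγ hη hγn hηn h
  have hmeet : γ s = η t := hst.proj_eq
  have h1 := hγ.after hs.1.le hs.2 le_rfl
  have h2 := hη.after ht.1.le ht.2 le_rfl
  have hy' : γ b = y ∨ S.After (γ b) y := hy.eq_or_after
  have hz' : η b' = z ∨ S.After (η b') z := hz.eq_or_after
  refine ⟨γ s, hγ.after le_rfl hs.1 hs.2.le, ?_, ?_⟩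
  · rw [hmeet]
    rcases hz' with rfl | hz'
    · exact h2
    · exact h2.trans hz'
  · rcases hy' with rfl | hy'
    · exact h1
    · exact h1.trans hy'

theorem isAfter2Frame [T2Space M] (S : Spacetime 2 M) : ModalFormula.IsAfter2Frame S.After := by
  intro x y₁ y₂ z h₁ h₂ hz hne h₁₂ h₂₁
  by_cases hp₁ : x ∈ S.past y₁
  · obtain ⟨w, hw, hwz, hwy⟩ := exists_after_of_mem_past hp₁ hz
    exact ⟨w, hw, hwz, Or.inl hwy⟩
  by_cases hp₂ : x ∈ S.past y₂
  · obtain ⟨w, hw, hwz, hwy⟩ := exists_after_of_mem_past hp₂ hz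
    exact ⟨w, hw, hwz, Or.inr hwy⟩
  by_cases hpz : x ∈ S.past z
  · obtain ⟨w, hw, hwy, hwz⟩ := exists_after_of_mem_past hpz h₁
    exact ⟨w, hw, hwz, Or.inl hwy⟩
  obtain ⟨γ₁, a₁, b₁, n₁, hab₁, hγ₁, hn₁, hx₁, hc₁⟩ := h₁.exists_nullChain hp₁
  obtain ⟨γ₂, a₂, b₂, n₂, hab₂, hγ₂, hn₂, hx₂, hc₂⟩ := h₂.exists_nullChain hp₂
  obtain ⟨γ₃, a₃, b₃, n₃, hab₃, hγ₃, hn₃, hx₃, hc₃⟩ := hz.exists_nullChain hpz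
  have key : ∀ {γ : ℝ → M} {a b : ℝ}, a < b → S.IsNullOn γ a b → γ a = x →
      ∃ v : TangentSpace (𝓡 2) x, velocityLift 2 γ a b a = ⟨x, v⟩ ∧ S.g x v v = 0 := by
    rintro γ a b hab hn rfl
    exact ⟨_, rfl, hn a (left_mem_Ico.2 hab)⟩
  obtain ⟨v₁, hv₁, hv₁0⟩ := key hab₁ hn₁ hx₁
  obtain ⟨v₂, hv₂, hv₂0⟩ := key hab₂ hn₂ hx₂
  obtain ⟨v₃, hv₃, hv₃0⟩ := key hab₃ hn₃ hx₃
  rcases orthogonal_of_three hv₁0 hv₂0 hv₃0 with h | h | h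
  · exfalso
    -- Each chain is started at its own initial vector, so the first curve counts as a piece; this
    -- explains the `+ 1`.
    have hcomp := NullChain.comparable (S := S) (n₁ := n₁ + 1) (n₂ := n₂ + 1)
      ⟨γ₁, a₁, b₁, hab₁, hγ₁, hn₁, hn₁.orthogonal_self (left_mem_Ico.2 hab₁), hc₁⟩
      ⟨γ₂, a₂, b₂, hab₂, hγ₂, hn₂, hn₂.orthogonal_self (left_mem_Ico.2 hab₂), hc₂⟩
      ⟨x, v₁, v₂, hv₁, hv₂, h⟩ (hγ₁.isFutureCausal (left_mem_Icc.2 hab₁.le))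
      (hγ₂.isFutureCausal (left_mem_Icc.2 hab₂.le))
    tauto
  · obtain ⟨w, hw, hwz, hwy⟩ := exists_after_of_orthogonal hab₁ hab₃ hγ₁ hγ₃ hn₁ hn₃ hc₁ hc₃
      ⟨x, v₁, v₃, hv₁, hv₃, h⟩
    exact ⟨w, hx₁ ▸ hw, hwz, Or.inl hwy⟩
  · obtain ⟨w, hw, hwz, hwy⟩ := exists_after_of_orthogonal hab₂ hab₃ hγ₂ hγ₃ hn₂ hn₃ hc₂ hc₃
      ⟨x, v₂, v₃, hv₂, hv₃, h⟩
    exact ⟨w, hx₂ ▸ hw, hwz, Or.inr hwy⟩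

end Spacetime

end

theorem mainTheorem2 {M : Type*} [TopologicalSpace M] [T2Space M]
    [ChartedSpace (EuclideanSpace ℝ (Fin 2)) M] [IsManifold (𝓡 2) ∞ M]
    (S : Spacetime 2 M) (AP : Type*) :
    (∀ p₁ p₂ q : AP, ModalFormula.ValidOn S.After
      (ModalFormula.after2 (ModalFormula.atom p₁) (ModalFormula.atom p₂) (ModalFormula.atom q))) ∧
    ModalFormula.logicD4da2 AP ⊆ ModalFormula.frameLogic AP S.After :=
  ⟨fun _ _ _ ↦ ModalFormula.validOn_after2 S.isAfter2Frame _ _ _,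
    ModalFormula.logicD4da2_subset_frameLogic (fun _ _ _ ↦ Spacetime.After.trans)
      S.exists_after (fun _ _ ↦ Spacetime.After.exists_between) S.isAfter2Frame⟩
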